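/- **Setting.** All spaces are nonzero finite-dimensional complex Euclidean spaces with a fixed standard basis. Let $r$ be a natural number, let $\mathcal X_1,\dots,\mathcal X_r$ (input spaces) and $\mathcal Y_1,\dots,\mathcal Y_r$ (output spaces) be given, and put $\mathcal X_{r+1}:=\mathbb C$, $\mathcal X_{1\ldots r}:=\mathcal X_1\otimes\cdots\otimes\mathcal X_r$, $\mathcal Y_{1\ldots r}:=\mathcal Y_1\otimes\cdots\otimes\mathcal Y_r$. An *$r$-round pure strategy* $\tilde A$ consists of memory spaces $\mathcal Z_0=\mathbb C,\mathcal Z_1,\dots,\mathcal Z_r$ and linear isometries $A_i:\mathcal X_i\otimes\mathcal Z_{i-1}\to\mathcal Y_i\otimes\mathcal Z_i$ ($1\le i\le r$). Composing $A_1,\dots,A_r$ (each tensored with identities) gives an isometry $\tilde A:\mathcal X_{1\ldots r}\to\mathcal Y_{1\ldots r}\otimes\mathcal Z_r$, hence a channel $\Phi_A(X)=\mathrm{Tr}_{\mathcal Z_r}(\tilde A X\tilde A^*)$. An *$r$-round strategy* is an operator on $\mathcal Y_{1\ldots r}\otimes\mathcal X_{1\ldots r}$ of the form $A=J(\Phi_A)=\sum_{a,b}\Phi_A(|a\rangle\langle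 b|)\otimes|a\rangle\langle b|$ for some pure strategy $\tilde A$, which is called a *purification* of $A$. An *$r$-round pure co-strategy* $\tilde B$ consists of memory spaces $\mathcal W_0,\dots,\mathcal W_r$, a unit vector $|\beta\rangle\in\mathcal X_1\otimes\mathcal W_0$ and linear isometries $B_i:\mathcal Y_i\otimes\mathcal W_{i-1}\to\mathcal X_{i+1}\otimes\mathcal W_i$ ($1\le i\le r$). The final state of the interaction is $$|\psi(\tilde A,\tilde B)\rangle=(I_{\mathcal Z_r}\otimes B_r)(A_r\otimes I_{\mathcal W_{r-1}})\cdots(I_{\mathcal Z_1}\otimes B_1)(A_1\otimes I_{\mathcal W_0})|\beta\rangle\in\mathcal Z_r\otimes\mathcal W_r,$$ and $\rho_A(\tilde B):=\mathrm{Tr}_{\mathcal Z_r}|\psi(\tilde A,\tilde B)\rangle\langle\psi(\tilde A,\tilde B)|$, which does not depend on the purification $\tilde A$ of $A$. For positive semidefinite $P,Q$ let $F(P,Q)=\|\sqrt P\sqrt Q\|_1$ with the trace norm $\|M\|_1=\mathrm{Tr}\sqrt{M^*M}$. The *strategy fidelity* of $r$-round strategies $S,T$ with the same input and output spaces is $$F_r(S,T)=\min_{\tilde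 B}F\bigl(\rho_S(\tilde B),\rho_T(\tilde B)\bigr),$$ where $\tilde B$ ranges over all $r$-round pure co-strategies for these spaces. Given also a natural number $r'$, input spaces $\mathcal X'_1,\dots,\mathcal X'_{r'}$ and output spaces $\mathcal Y'_1,\dots,\mathcal Y'_{r'}$, a *strategy supermap* from $r$-round to $r'$-round strategies is a completely positive linear map $\Upsilon$ from the operators on $\mathcal Y_{1\ldots r}\otimes\mathcal X_{1\ldots r}$ to the operators on $\mathcal Y'_{1\ldots r'}\otimes\mathcal X'_{1\ldots r'}$ that maps every $r$-round strategy to an $r'$-round strategy. **Theorem (monotonicity of the strategy fidelity).** For all natural numbers $r,r'$, all input and output spaces as above, all $r$-round strategies $S,T$, and all strategy supermaps $\Upsilon$ from $r$-round strategies to $r'$-round strategies, $$F_{r'}(\Upsilon(S),\Upsilon(T))\ \ge\ F_r(S,T).$$ -/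

import Mathlib

/-!
Operators between complex Euclidean spaces with a fixed standard basis are written as complex
matrices indexed by the basis labels. The space `ℂ^n` has basis labels `Fin n`, a tensor product of
two spaces has pairs of labels, and `X₁ ⊗ ⋯ ⊗ X_r` has `r`-tuples of labels.
-/

namespace QuantumStrategy

open Matrix

noncomputable section

/-- The dimensions of the input spaces `X₁, …, X_r` and of the output spaces `Y₁, …, Y_r` of an
`r`-round strategy, all positive. Rounds are counted from `0`, so `inDim i.castSucc` and `outDim i`
belong to round `i`; the extra entry `inDim (Fin.last r) = 1` is the convention `X_{r+1} = ℂ`. -/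
structure Spaces (r : ℕ) where
  inDim : Fin (r + 1) → ℕ
  outDim : Fin r → ℕ
  inDim_pos : ∀ k, 0 < inDim k
  outDim_pos : ∀ i, 0 < outDim i
  inDim_last : inDim (Fin.last r) = 1

variable {r : ℕ}

/-- Basis labels of `X₁ ⊗ ⋯ ⊗ X_r`. -/
abbrev Spaces.In (H : Spaces r) : Type := ∀ i : Fin r, Fin (H.inDim i.castSucc)

/-- Basis labels of `Y₁ ⊗ ⋯ ⊗ Y_r`. -/
abbrev Spaces.Out (H : Spaces r) : Type := ∀ i : Fin r, Fin (H.outDim i)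

/-- Linear operators on `Y₁ ⊗ ⋯ ⊗ Y_r ⊗ X₁ ⊗ ⋯ ⊗ X_r`. -/
abbrev Spaces.Op (H : Spaces r) : Type := Matrix (H.Out × H.In) (H.Out × H.In) ℂ

/-- An `r`-round pure strategy: memory spaces `Z₀ = ℂ, Z₁, …, Z_r` (given by their dimensions) and
linear isometries `A_i : X_i ⊗ Z_{i-1} → Y_i ⊗ Z_i`. -/
structure PureStrategy (H : Spaces r) where
  mem : Fin (r + 1) → ℕ
  mem_zero : mem 0 = 1
  op : ∀ i : Fin r, Matrix (Fin (H.outDim i) × Fin (mem i.succ))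
    (Fin (H.inDim i.castSucc) × Fin (mem i.castSucc)) ℂ
  op_isometry : ∀ i, (op i)ᴴ * op i = 1

/-- An `r`-round pure co-strategy: memory spaces `W₀, …, W_r`, a unit vector `β ∈ X₁ ⊗ W₀` and
linear isometries `B_i : Y_i ⊗ W_{i-1} → X_{i+1} ⊗ W_i`. -/
structure PureCoStrategy (H : Spaces r) where
  mem : Fin (r + 1) → ℕ
  init : Fin (H.inDim 0) × Fin (mem 0) → ℂ
  init_unit : ∑ p, ‖init p‖ ^ 2 = 1
  op : ∀ i : Fin r, Matrix (Fin (H.inDim i.succ) × Fin (mem i.succ))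
    (Fin (H.outDim i) × Fin (mem i.castSucc)) ℂ
  op_isometry : ∀ i, (op i)ᴴ * op i = 1

/-- Partial trace over the second tensor factor. -/
def traceRight {m n : Type*} [Fintype n] (M : Matrix (m × n) (m × n) ℂ) : Matrix m m ℂ :=
  Matrix.of fun a b => ∑ k, M (a, k) (b, k)

/-- Partial trace over the first tensor factor. -/
def traceLeft {m n : Type*} [Fintype m] (M : Matrix (m × n) (m × n) ℂ) : Matrix n n ℂ :=
  Matrix.of fun a b => ∑ k, M (k, a) (k, b)

/-- The Choi-Jamiołkowski representation `J(Φ) = ∑ Φ(|a⟩⟨b|) ⊗ |a⟩⟨b|`. -/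
def choi {m n : Type*} [DecidableEq n] (Φ : Matrix n n ℂ → Matrix m m ℂ) :
    Matrix (m × n) (m × n) ℂ :=
  Matrix.of fun p q => Φ (Matrix.single p.2 q.2 1) p.1 q.1

namespace PureStrategy

variable {H : Spaces r} (A : PureStrategy H)

/-- The vector in the memory space that remains after the isometries of the first `k` rounds have
been applied to the basis vector `x` and the output has been projected to the basis vector `y`. -/
def amplitude (x : H.In) (y : H.Out) (k : Fin (r + 1)) : Fin (A.mem k) → ℂ :=
  Fin.induction (motive := fun k => Fin (A.mem k) → ℂ)
    (fun _ => 1)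
    (fun i v z' => ∑ z, A.op i (y i, z') (x i, z) * v z) k

/-- The single isometry `X₁ ⊗ ⋯ ⊗ X_r → Y₁ ⊗ ⋯ ⊗ Y_r ⊗ Z_r` that represents the pure strategy:
the composition of `A₁, …, A_r`, each extended by identities. -/
def toMatrix : Matrix (H.Out × Fin (A.mem (Fin.last r))) H.In ℂ :=
  Matrix.of fun p x => A.amplitude x p.1 (Fin.last r) p.2

/-- The channel `X ↦ Tr_{Z_r} (Ã X Ã*)`. -/
def channel (X : Matrix H.In H.In ℂ) : Matrix H.Out H.Out ℂ :=
  traceRight (A.toMatrix * X * A.toMatrixᴴ)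

/-- `A` is a purification of the strategy with Choi-Jamiołkowski representation `S`. -/
def IsPurificationOf (S : H.Op) : Prop := choi A.channel = S

/-- The joint vector in `X_{k+1} ⊗ Z_k ⊗ W_k` after `k` rounds of interaction; a round applies
`A_i ⊗ I` and then `I ⊗ B_i`. -/
def stateAfter (B : PureCoStrategy H) (k : Fin (r + 1)) :
    Fin (H.inDim k) × Fin (A.mem k) × Fin (B.mem k) → ℂ :=
  Fin.induction
    (motive := fun k => Fin (H.inDim k) × Fin (A.mem k) × Fin (B.mem k) → ℂ)
    (fun p => B.init (p.1, p.2.2))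
    (fun i φ p => ∑ y, ∑ w, B.op i (p.1, p.2.2) (y, w) *
      ∑ x, ∑ z, A.op i (y, p.2.1) (x, z) * φ (x, z, w)) k

/-- The final state `|ψ(Ã, B̃)⟩ ∈ Z_r ⊗ W_r`, where `X_{r+1} = ℂ` is dropped. -/
def finalState (B : PureCoStrategy H) :
    Fin (A.mem (Fin.last r)) × Fin (B.mem (Fin.last r)) → ℂ :=
  fun p => A.stateAfter B (Fin.last r) (⟨0, H.inDim_pos _⟩, p)

/-- The reduced state `Tr_{Z_r} |ψ(Ã, B̃)⟩⟨ψ(Ã, B̃)|` of the final memory of `B̃`. -/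
def reducedState (B : PureCoStrategy H) :
    Matrix (Fin (B.mem (Fin.last r))) (Fin (B.mem (Fin.last r))) ℂ :=
  traceLeft (Matrix.vecMulVec (A.finalState B) (star (A.finalState B)))

end PureStrategy

/-- `S` is (the Choi-Jamiołkowski representation of) an `r`-round strategy. -/
def IsStrategy {H : Spaces r} (S : H.Op) : Prop := ∃ A : PureStrategy H, A.IsPurificationOf S

section Fidelity

open scoped MatrixOrder

variable {n : Type*} [Fintype n] [DecidableEq n]

/-- The trace norm `Tr √(M* M)`. -/
def traceNorm (M : Matrix n n ℂ) : ℝ := (CFC.sqrt (Mᴴ * M)).trace.re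

/-- The fidelity `‖√P √Q‖₁` of positive semidefinite operators. -/
def fidelity (P Q : Matrix n n ℂ) : ℝ := traceNorm (CFC.sqrt P * CFC.sqrt Q)

end Fidelity

/-- The strategy fidelity: the minimum, over all co-strategies, of the fidelity of the two reduced
final states. A co-strategy enters through its purifications `B`, which together are all the pure
co-strategies, and the reduced states do not depend on the purifications of `S` and `T`. -/
def strategyFidelity {H : Spaces r} (S T : H.Op) : ℝ :=
  sInf {f : ℝ | ∃ (A₁ A₂ : PureStrategy H) (B : PureCoStrategy H),
    A₁.IsPurificationOf S ∧ A₂.IsPurificationOf T ∧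
      f = fidelity (A₁.reducedState B) (A₂.reducedState B)}

section CompletePositivity

open scoped MatrixOrder Matrix.Norms.L2Operator

/-- `Υ` is completely positive, with the operators on a complex Euclidean space as the C⋆-algebra
under the operator norm and the positive semidefinite order. -/
def IsCompletelyPositive {m n : Type*} [Fintype m] [DecidableEq m] [Fintype n] [DecidableEq n]
    (Υ : Matrix m m ℂ →ₗ[ℂ] Matrix n n ℂ) : Prop :=
  ∃ Ψ : CompletelyPositiveMap (Matrix m m ℂ) (Matrix n n ℂ), ∀ M, Ψ M = Υ M

end CompletePositivity

/-- Strategy supermaps: completely positive linear maps of operators that send `r`-round strategies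
to `r'`-round strategies. -/
structure IsStrategySupermap {r r' : ℕ} {H : Spaces r} {H' : Spaces r'}
    (Υ : H.Op →ₗ[ℂ] H'.Op) : Prop where
  completelyPositive : IsCompletelyPositive Υ
  map_strategy : ∀ S : H.Op, IsStrategy S → IsStrategy (Υ S)

end

end QuantumStrategy

/-! Let `C` be the amplitude matrix of a purification of S, so that S = C C*, and let `Q` be the
operator of a co-strategy. As a matrix the final state is M C with Q = M* M, so the fidelity of the
two reduced states is ‖C_S* Q C_T‖₁ (`fidelity_reducedState`). The co-strategy enters only through
`Q`.

Given a co-strategy with operator Q' on the target side and Kraus operators K_j of Υ, put Q = Σ K_j*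
Q' K_j, the adjoint of Υ applied to Q'. It is positive semidefinite, and Tr(Q S) = Tr(Q' Υ(S)) = 1
for every strategy S, which makes it the operator of a co-strategy
(`exists_pureCoStrategy_operator_eq`). Now C_S* Q C_T is the partial trace over j of the matrix with
blocks (K_i C_S)* Q' (K_j C_T). The partial trace does not increase the trace norm, and the columns
K_j C_S, side by side, factor Υ(S). So the pulled-back co-strategy has fidelity at most that of the
given one (`rectTraceNorm_kraus_le`).

The substantial step is the characterisation of co-strategy operators. Perturbing the completely
noisy strategy in admissible directions shows that `Q` is orthogonal to these directions
(`IsPerturbation.pairing_eq_zero`). Matrix-unit directions then give the partial trace conditions of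
a co-strategy (`sum_piecewise_setY`). Under these conditions the marginals of `Q` are Gram matrices
of successive memory vectors, and vectors with equal Gram matrices are related by isometries, which
are the rounds (`exists_pureCoStrategy`). -/

namespace QuantumStrategy

open Matrix
open scoped ComplexOrder

noncomputable section

/-! ### Isometries from equal Gram matrices -/

section Isometry

/-- Inner products determine the norms of linear combinations, so every linear relation among the `a
t` holds among the `b t`. Hence `a t ↦ b t` is a well-defined isometry on the span, and it extends
to `E` by finite dimension. -/
theorem exists_linearIsometry_of_inner_eq {τ E : Type*} [NormedAddCommGroup E]
    [InnerProductSpace ℂ E] [FiniteDimensional ℂ E] (a b : τ → E)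
    (h : ∀ s t, inner ℂ (a s) (a t) = inner ℂ (b s) (b t)) :
    ∃ L : E →ₗᵢ[ℂ] E, ∀ t, L (a t) = b t := by
  let f : (τ →₀ ℂ) →ₗ[ℂ] E := Finsupp.linearCombination ℂ a
  let g : (τ →₀ ℂ) →ₗ[ℂ] E := Finsupp.linearCombination ℂ b
  have hfg : ∀ c d, inner ℂ (f c) (f d) = inner ℂ (g c) (g d) := by
    intro c d
    simp only [f, g, Finsupp.linearCombination_apply, Finsupp.sum, sum_inner, inner_sum,
      inner_smul_left, inner_smul_right, h]
  have hker : f.ker ≤ g.ker := by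
    intro c hc
    rw [LinearMap.mem_ker] at hc ⊢
    rw [← inner_self_eq_zero (𝕜 := ℂ), ← hfg, hc, inner_zero_left]
  let L₀ : f.range →ₗ[ℂ] E := (f.ker.liftQ g hker) ∘ₗ f.quotKerEquivRange.symm.toLinearMap
  have hL₀ : ∀ c, L₀ ⟨f c, c, rfl⟩ = g c := by
    intro c
    have : (⟨f c, c, rfl⟩ : f.range) = f.quotKerEquivRange (f.ker.mkQ c) := rfl
    rw [this]
    simp only [L₀, LinearMap.comp_apply, LinearEquiv.coe_coe, LinearEquiv.symm_apply_apply]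
    rfl
  have hiso : ∀ x y, inner ℂ (L₀ x) (L₀ y) = inner ℂ x y := by
    rintro ⟨_, c, rfl⟩ ⟨_, d, rfl⟩
    rw [hL₀, hL₀, ← hfg]
    rfl
  refine ⟨(L₀.isometryOfInner hiso).extend, fun t => ?_⟩
  have ht : f (Finsupp.single t 1) = a t := by simp [f]
  have := (L₀.isometryOfInner hiso).extend_apply ⟨f (Finsupp.single t 1), _, rfl⟩
  rw [LinearMap.coe_isometryOfInner, hL₀] at this
  simpa [ht, g] using this

/-- Two families of vectors with the same Gram matrix are related by an isometry. -/
theorem exists_isometry_of_gram_eq {τ m n : Type*} [Fintype m] [Fintype n] [DecidableEq m]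
    (hcard : Fintype.card m ≤ Fintype.card n) (u : τ → m → ℂ) (v : τ → n → ℂ)
    (h : ∀ s t, star (u s) ⬝ᵥ u t = star (v s) ⬝ᵥ v t) :
    ∃ V : Matrix n m ℂ, Vᴴ * V = 1 ∧ ∀ t, V *ᵥ u t = v t := by
  classical
  obtain ⟨e⟩ := Function.Embedding.nonempty_of_card_le hcard
  -- A coordinate embedding puts both families into one space.
  let J : Matrix n m ℂ := Matrix.of fun i j => if i = e j then (1 : ℂ) else 0
  have hJ : Jᴴ * J = 1 := by
    ext i j
    simp [J, Matrix.mul_apply, Matrix.one_apply, e.injective.eq_iff, apply_ite, eq_comm]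
  obtain ⟨L, hL⟩ := exists_linearIsometry_of_inner_eq
    (fun t => WithLp.toLp 2 (J *ᵥ u t)) (fun t => (WithLp.toLp 2 (v t) : EuclideanSpace ℂ n)) (by
      intro s t
      simp only [EuclideanSpace.inner_eq_star_dotProduct]
      rw [dotProduct_comm, star_mulVec, dotProduct_mulVec, vecMul_vecMul, hJ, vecMul_one, h,
        dotProduct_comm])
  let M : Matrix n n ℂ := Matrix.toEuclideanLin.symm L.toLinearMap
  have hM : ∀ x : n → ℂ, WithLp.toLp 2 (M *ᵥ x) = L (WithLp.toLp 2 x) := by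
    intro x
    have : Matrix.toEuclideanLin M = L.toLinearMap := by simp [M]
    rw [← L.coe_toLinearMap, ← this]
    rfl
  have hMM : Mᴴ * M = 1 := by
    ext i j
    have := L.inner_map_map (WithLp.toLp 2 (Pi.single i 1)) (WithLp.toLp 2 (Pi.single j 1))
    rw [← hM, ← hM] at this
    simp only [EuclideanSpace.inner_eq_star_dotProduct] at this
    rw [dotProduct_comm, star_mulVec, dotProduct_mulVec, vecMul_vecMul] at this
    simpa [Matrix.one_apply, Pi.single_apply, eq_comm] using this
  refine ⟨M * J, ?_, fun t => ?_⟩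
  · rw [conjTranspose_mul, Matrix.mul_assoc, ← Matrix.mul_assoc Mᴴ, hMM, Matrix.one_mul, hJ]
  · rw [← mulVec_mulVec]
    have := hM (J *ᵥ u t)
    rw [hL] at this
    exact WithLp.toLp_injective 2 this

theorem exists_isometry {m n : Type*} [Fintype m] [Fintype n] [DecidableEq m]
    (hcard : Fintype.card m ≤ Fintype.card n) : ∃ V : Matrix n m ℂ, Vᴴ * V = 1 :=
  let ⟨V, hV, _⟩ := exists_isometry_of_gram_eq hcard (τ := Empty) Empty.elim Empty.elim
    (fun s => s.elim)
  ⟨V, hV⟩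

theorem exists_isometry_of_conjTranspose_mul_self_eq {l m n : Type*} [Fintype m] [Fintype n]
    [DecidableEq m] (hcard : Fintype.card m ≤ Fintype.card n) (X : Matrix m l ℂ)
    (Y : Matrix n l ℂ) (h : Xᴴ * X = Yᴴ * Y) :
    ∃ V : Matrix n m ℂ, Vᴴ * V = 1 ∧ V * X = Y := by
  obtain ⟨V, hV, hVX⟩ := exists_isometry_of_gram_eq hcard Xᵀ Yᵀ
    (fun s t => congrFun (congrFun h s) t)
  refine ⟨V, hV, ?_⟩
  ext i j
  exact congrFun (hVX j) i

open scoped MatrixOrder in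
/-- A positive semidefinite kernel is a Gram matrix in every space of large enough dimension. -/
theorem exists_gram_of_posSemidef {P : Type*} [Fintype P] {K : Matrix P P ℂ}
    (hK : K.PosSemidef) {N : ℕ} (hN : Fintype.card P ≤ N) :
    ∃ g : P → Fin N → ℂ, ∀ p p', star (g p) ⬝ᵥ g p' = K p p' := by
  classical
  obtain ⟨B, rfl⟩ := CStarAlgebra.nonneg_iff_eq_star_mul_self.mp hK.nonneg
  obtain ⟨V, hV⟩ := exists_isometry (m := P) (n := Fin N) (by simpa using hN)
  refine ⟨fun p => V *ᵥ (fun i => B i p), fun p p' => ?_⟩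
  rw [star_mulVec, dotProduct_mulVec, vecMul_vecMul, hV, vecMul_one]
  rfl

theorem star_mulVec_dotProduct_mulVec {m n : Type*} [Fintype m] [Fintype n]
    [DecidableEq n] {V : Matrix m n ℂ} (hV : Vᴴ * V = 1) (u : n → ℂ) :
    star (V *ᵥ u) ⬝ᵥ (V *ᵥ u) = star u ⬝ᵥ u := by
  rw [star_mulVec, dotProduct_mulVec, vecMul_vecMul, hV, vecMul_one]

end Isometry

/-! ### Trace norm, fidelity and partial trace -/

section TraceNorm

open scoped MatrixOrder

set_option linter.unusedSectionVars false

variable {m n : Type*} [Fintype m] [Fintype n] [DecidableEq m] [DecidableEq n]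

/-- The trace norm `Tr √(X* X)` of an operator between two spaces. -/
def rectTraceNorm (X : Matrix m n ℂ) : ℝ := (CFC.sqrt (Xᴴ * X)).trace.re

theorem sqrt_conjTranspose (P : Matrix n n ℂ) : (CFC.sqrt P)ᴴ = CFC.sqrt P :=
  (CFC.sqrt_nonneg P).posSemidef.isHermitian

theorem sqrt_mul_sqrt_of_posSemidef {P : Matrix n n ℂ} (h : P.PosSemidef) :
    CFC.sqrt P * CFC.sqrt P = P :=
  CFC.sqrt_mul_sqrt_self P h.nonneg

theorem rectTraceNorm_nonneg (X : Matrix m n ℂ) : 0 ≤ rectTraceNorm X :=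
  (RCLike.nonneg_iff.mp (CFC.sqrt_nonneg (Xᴴ * X)).posSemidef.trace_nonneg).1

/-- Polar decomposition: `√(X* X)` and `X` have the same Gram matrix of columns. -/
theorem exists_polar (hcard : Fintype.card n ≤ Fintype.card m) (X : Matrix m n ℂ) :
    ∃ V : Matrix m n ℂ, Vᴴ * V = 1 ∧ V * CFC.sqrt (Xᴴ * X) = X :=
  exists_isometry_of_conjTranspose_mul_self_eq hcard _ _ (by
    rw [sqrt_conjTranspose, sqrt_mul_sqrt_of_posSemidef (posSemidef_conjTranspose_mul_self X)])

theorem rectTraceNorm_conjTranspose_of_card_le (hcard : Fintype.card n ≤ Fintype.card m)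
    (X : Matrix m n ℂ) : rectTraceNorm Xᴴ = rectTraceNorm X := by
  obtain ⟨V, hV, hX⟩ := exists_polar hcard X
  have hsq : CFC.sqrt (Xᴴᴴ * Xᴴ) = V * CFC.sqrt (Xᴴ * X) * Vᴴ := by
    rw [CFC.sqrt_eq_iff _ _ (posSemidef_conjTranspose_mul_self _).nonneg
      ((CFC.sqrt_nonneg (Xᴴ * X)).posSemidef.mul_mul_conjTranspose_same V).nonneg,
      conjTranspose_conjTranspose]
    calc V * CFC.sqrt (Xᴴ * X) * Vᴴ * (V * CFC.sqrt (Xᴴ * X) * Vᴴ)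
        = V * CFC.sqrt (Xᴴ * X) * (Vᴴ * V) * (CFC.sqrt (Xᴴ * X) * Vᴴ) := by
          simp only [Matrix.mul_assoc]
      _ = V * CFC.sqrt (Xᴴ * X) * (V * CFC.sqrt (Xᴴ * X))ᴴ := by
          rw [hV, Matrix.mul_one, conjTranspose_mul, sqrt_conjTranspose]
      _ = X * Xᴴ := by rw [hX]
  rw [rectTraceNorm, rectTraceNorm, hsq, trace_mul_comm, ← Matrix.mul_assoc, hV, Matrix.one_mul]

theorem rectTraceNorm_conjTranspose (X : Matrix m n ℂ) :
    rectTraceNorm Xᴴ = rectTraceNorm X := by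
  rcases le_total (Fintype.card n) (Fintype.card m) with h | h
  · exact rectTraceNorm_conjTranspose_of_card_le h X
  · have := rectTraceNorm_conjTranspose_of_card_le h Xᴴ
    rwa [conjTranspose_conjTranspose, eq_comm] at this

theorem rectTraceNorm_congr_left {l : Type*} [Fintype l] [DecidableEq l] {X : Matrix m n ℂ}
    {Y : Matrix l n ℂ} (h : Xᴴ * X = Yᴴ * Y) : rectTraceNorm X = rectTraceNorm Y := by
  rw [rectTraceNorm, rectTraceNorm, h]

theorem rectTraceNorm_congr_right {l : Type*} [Fintype l] [DecidableEq l] {X : Matrix m n ℂ}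
    {Y : Matrix m l ℂ} (h : X * Xᴴ = Y * Yᴴ) : rectTraceNorm X = rectTraceNorm Y := by
  rw [← rectTraceNorm_conjTranspose X, ← rectTraceNorm_conjTranspose Y]
  exact rectTraceNorm_congr_left (by simpa using h)

/-- `√(M M*)` may be replaced by `M` in both arguments of the fidelity. -/
theorem fidelity_mul_conjTranspose {l : Type*} [Fintype l] [DecidableEq l] (M : Matrix l m ℂ)
    (N : Matrix l n ℂ) : fidelity (M * Mᴴ) (N * Nᴴ) = rectTraceNorm (Mᴴ * N) := by
  have hM := sqrt_mul_sqrt_of_posSemidef (posSemidef_self_mul_conjTranspose M)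
  have hN := sqrt_mul_sqrt_of_posSemidef (posSemidef_self_mul_conjTranspose N)
  have h2 : rectTraceNorm (CFC.sqrt (M * Mᴴ) * CFC.sqrt (N * Nᴴ))
      = rectTraceNorm (Mᴴ * CFC.sqrt (N * Nᴴ)) := by
    apply rectTraceNorm_congr_left
    simp only [conjTranspose_mul, conjTranspose_conjTranspose, sqrt_conjTranspose]
    rw [Matrix.mul_assoc, ← Matrix.mul_assoc (CFC.sqrt (M * Mᴴ)), hM]
    simp only [Matrix.mul_assoc]
  have h3 : rectTraceNorm (Mᴴ * CFC.sqrt (N * Nᴴ)) = rectTraceNorm (Mᴴ * N) := by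
    apply rectTraceNorm_congr_right
    simp only [conjTranspose_mul, conjTranspose_conjTranspose, sqrt_conjTranspose]
    rw [Matrix.mul_assoc, ← Matrix.mul_assoc (CFC.sqrt (N * Nᴴ)), hN]
    simp only [Matrix.mul_assoc]
  rw [← h3, ← h2]
  rfl

/-- With R = C* C, expand Tr |(G − V) C*|² ≥ 0. This is the part of trace norm duality that the
partial trace needs. -/
theorem re_trace_isometry_mul_le {G V : Matrix m n ℂ} (hG : Gᴴ * G = 1) (hV : Vᴴ * V = 1)
    {R : Matrix n n ℂ} (hR : R.PosSemidef) : (Gᴴ * V * R).trace.re ≤ R.trace.re := by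
  obtain ⟨C, rfl⟩ := CStarAlgebra.nonneg_iff_eq_star_mul_self.mp hR.nonneg
  rw [star_eq_conjTranspose]
  have h0 := (RCLike.nonneg_iff.mp
    (posSemidef_conjTranspose_mul_self (G * Cᴴ - V * Cᴴ)).trace_nonneg).1
  have h1 : (G * Cᴴ - V * Cᴴ)ᴴ * (G * Cᴴ - V * Cᴴ)
      = C * (Gᴴ * G) * Cᴴ + C * (Vᴴ * V) * Cᴴ - C * (Gᴴ * V) * Cᴴ - (C * (Gᴴ * V) * Cᴴ)ᴴ := by
    simp only [conjTranspose_sub, conjTranspose_mul, conjTranspose_conjTranspose, Matrix.sub_mul,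
      Matrix.mul_sub, Matrix.mul_assoc]
    abel
  rw [h1, hG, hV, Matrix.mul_one] at h0
  simp only [trace_sub, trace_add, trace_conjTranspose, map_sub, map_add, RCLike.re_to_complex,
    Complex.star_def, Complex.conj_re] at h0
  rw [trace_mul_cycle C (Gᴴ * V) Cᴴ, trace_mul_comm _ (Gᴴ * V), trace_mul_comm C] at h0
  linarith

/-- With `V` the polar isometry of the partial trace Y, ‖Y‖₁ = Tr(V* Y) = Tr((1 ⊗ V)* X) ≤ ‖X‖₁. The
matrix `G` below is 1 ⊗ V. -/
theorem rectTraceNorm_partialTrace_le_of_card_le {J : Type*} [Fintype J] [DecidableEq J]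
    (hcard : Fintype.card n ≤ Fintype.card m) (X : Matrix (J × m) (J × n) ℂ) :
    rectTraceNorm (Matrix.of fun a b => ∑ j, X (j, a) (j, b)) ≤ rectTraceNorm X := by
  set Y : Matrix m n ℂ := Matrix.of fun a b => ∑ j, X (j, a) (j, b) with hYdef
  obtain ⟨V, hV, hY⟩ := exists_polar hcard Y
  obtain ⟨W, hW, hX⟩ := exists_polar (X := X) (by
    simpa [Fintype.card_prod] using Nat.mul_le_mul_left _ hcard)
  let G : Matrix (J × m) (J × n) ℂ := Matrix.of fun a b => if a.1 = b.1 then V a.2 b.2 else 0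
  have hG : Gᴴ * G = 1 := by
    ext a b
    have := congrFun (congrFun hV a.2) b.2
    simp only [Matrix.mul_apply, conjTranspose_apply, one_apply] at this
    simp only [G, Matrix.mul_apply, conjTranspose_apply, of_apply, Fintype.sum_prod_type,
      one_apply, Prod.ext_iff]
    rw [Finset.sum_eq_single a.1 (fun c _ hc => by simp [hc]) (by simp)]
    by_cases hab : a.1 = b.1
    · simpa [hab] using this
    · simp [hab]
  have hYtr : (CFC.sqrt (Yᴴ * Y)).trace = (Gᴴ * X).trace := by
    have : CFC.sqrt (Yᴴ * Y) = Vᴴ * Y := by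
      conv_rhs => rw [← hY, ← Matrix.mul_assoc, hV, Matrix.one_mul]
    rw [this]
    simp only [trace, diag, Matrix.mul_apply, conjTranspose_apply, G, of_apply, hYdef,
      Fintype.sum_prod_type, Finset.mul_sum, apply_ite star, star_zero, ite_mul, zero_mul]
    calc ∑ b, ∑ a, ∑ j, star (V a b) * X (j, a) (j, b)
        = ∑ b, ∑ j, ∑ a, star (V a b) * X (j, a) (j, b) :=
          Finset.sum_congr rfl fun _ _ => Finset.sum_comm
      _ = ∑ j, ∑ b, ∑ a, star (V a b) * X (j, a) (j, b) := Finset.sum_comm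
      _ = _ := by
          refine Finset.sum_congr rfl fun j _ => Finset.sum_congr rfl fun b _ => ?_
          rw [Finset.sum_eq_single j (fun c _ hc => by simp [hc]) (by simp)]
          simp
  rw [rectTraceNorm, hYtr, rectTraceNorm]
  conv_lhs => rw [← hX, ← Matrix.mul_assoc]
  exact re_trace_isometry_mul_le hG hW (CFC.sqrt_nonneg (Xᴴ * X)).posSemidef

/-- The partial trace does not increase the trace norm. -/
theorem rectTraceNorm_partialTrace_le {J : Type*} [Fintype J] [DecidableEq J]
    (X : Matrix (J × m) (J × n) ℂ) :
    rectTraceNorm (Matrix.of fun a b => ∑ j, X (j, a) (j, b)) ≤ rectTraceNorm X := by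
  rcases le_total (Fintype.card n) (Fintype.card m) with h | h
  · exact rectTraceNorm_partialTrace_le_of_card_le h X
  · have := rectTraceNorm_partialTrace_le_of_card_le h Xᴴ
    rw [rectTraceNorm_conjTranspose, ← rectTraceNorm_conjTranspose] at this
    convert this using 2
    ext a b
    simp

end TraceNorm

/-! ### Kraus representations -/

section Kraus

open scoped MatrixOrder Matrix.Norms.L2Operator
open scoped CStarAlgebra

theorem exists_eq_star_mul_self_of_nonneg {A : Type*} [NonUnitalCStarAlgebra A] [PartialOrder A]
    [StarOrderedRing A] {a : A} (ha : 0 ≤ a) : ∃ b, a = star b * b :=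
  CStarAlgebra.nonneg_iff_eq_star_mul_self.mp ha

/-- Completely positive maps have Kraus representations. -/
theorem IsCompletelyPositive.exists_kraus {m n : Type} [Fintype m] [DecidableEq m] [Fintype n]
    [DecidableEq n] {Υ : Matrix m m ℂ →ₗ[ℂ] Matrix n n ℂ} (h : IsCompletelyPositive Υ) :
    ∃ K : m × n → Matrix n m ℂ, ∀ M, Υ M = ∑ j, K j * M * (K j)ᴴ := by
  obtain ⟨Ψ, hΨ⟩ := h
  -- The block matrix of matrix units is positive, and applying `Ψ` to its blocks gives the Choi
  -- matrix of `Υ`.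
  let Ω : CStarMatrix m m (Matrix m m ℂ) := CStarMatrix.ofMatrix fun i j => Matrix.single i j 1
  have hΩ : 0 ≤ Ω := by
    rcases isEmpty_or_nonempty m with hm | ⟨⟨i₀⟩⟩
    · have : Ω = 0 := by ext i; exact hm.elim i
      rw [this]
    -- Only row `i₀` is nonzero; `star v * v = Ω` because E_{i i₀} E_{i₀ j} = E_{ij}.
    let v : CStarMatrix m m (Matrix m m ℂ) :=
      CStarMatrix.ofMatrix fun i j => if i = i₀ then Matrix.single i₀ j 1 else 0
    have : Ω = star v * v := by
      apply CStarMatrix.ext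
      intro i j
      rw [CStarMatrix.mul_apply, Finset.sum_eq_single i₀]
      · change Matrix.single i j (1 : ℂ) =
          star (if i₀ = i₀ then Matrix.single i₀ i (1 : ℂ) else 0) *
          (if i₀ = i₀ then Matrix.single i₀ j (1 : ℂ) else 0)
        simp [star_eq_conjTranspose]
      · intro l _ hl
        change star (if l = i₀ then Matrix.single i₀ i (1 : ℂ) else 0) *
          (if l = i₀ then Matrix.single i₀ j (1 : ℂ) else 0) = 0
        simp [hl]
      · simp
    rw [this]
    exact star_mul_self_nonneg v
  obtain ⟨Y, hY⟩ := exists_eq_star_mul_self_of_nonneg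
    (CompletelyPositiveMap.map_cstarMatrix_nonneg Ψ Ω hΩ)
  have hent : ∀ i j, Υ (Matrix.single i j 1) = ∑ l, (Y l i)ᴴ * Y l j := by
    intro i j
    rw [← hΨ]
    have := congrFun (congrFun hY i) j
    rw [CStarMatrix.mul_apply] at this
    exact this
  -- Each scalar row of the square root `Y` of the Choi matrix, conjugated, is one Kraus operator.
  refine ⟨fun l => Matrix.of fun a i => star (Y l.1 i l.2 a), fun M => ?_⟩
  have hM : M = ∑ i, ∑ j, M i j • Matrix.single i j (1 : ℂ) := by
    conv_lhs => rw [Matrix.matrix_eq_sum_single M]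
    simp
  conv_lhs => rw [hM]
  simp only [map_sum, map_smul, hent]
  ext a b
  simp only [Matrix.sum_apply, Matrix.smul_apply, Matrix.mul_apply, conjTranspose_apply, of_apply,
    Fintype.sum_prod_type, star_star, smul_eq_mul, Finset.mul_sum, Finset.sum_mul]
  calc ∑ i, ∑ j, ∑ l, ∑ c, M i j * (star (Y l i c a) * Y l j c b)
      = ∑ i, ∑ l, ∑ c, ∑ j, M i j * (star (Y l i c a) * Y l j c b) := by
        refine Finset.sum_congr rfl fun i _ => ?_
        rw [Finset.sum_comm]
        exact Finset.sum_congr rfl fun l _ => Finset.sum_comm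
    _ = ∑ l, ∑ c, ∑ i, ∑ j, M i j * (star (Y l i c a) * Y l j c b) := by
        rw [Finset.sum_comm]
        exact Finset.sum_congr rfl fun l _ => Finset.sum_comm
    _ = _ := by
        refine Finset.sum_congr rfl fun l _ => Finset.sum_congr rfl fun c _ => ?_
        rw [Finset.sum_comm]
        refine Finset.sum_congr rfl fun j _ => Finset.sum_congr rfl fun i _ => ?_
        ring

end Kraus

/-! ### Sums over tuples with one replaced coordinate -/

section PiSums

variable {ι : Type*} [Fintype ι] [DecidableEq ι] {α : ι → Type*} [∀ s, Fintype (α s)]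

/-- Exchanging the coordinate at `s` with `v` is an involution on pairs `(p, v)`. -/
theorem sum_sum_update (s : ι) (G : (∀ s, α s) → ℂ) :
    ∑ p, ∑ v, G (Function.update p s v) = Fintype.card (α s) * ∑ p, G p := by
  let e : (∀ s, α s) × α s ≃ (∀ s, α s) × α s :=
    { toFun := fun q => (Function.update q.1 s q.2, q.1 s)
      invFun := fun q => (Function.update q.1 s q.2, q.1 s)
      left_inv := fun q => by simp
      right_inv := fun q => by simp }
  calc ∑ p, ∑ v, G (Function.update p s v)
      = ∑ q : (∀ s, α s) × α s, G (e q).1 := by rw [Fintype.sum_prod_type]; rfl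
    _ = ∑ q : (∀ s, α s) × α s, G q.1 := Equiv.sum_comp e fun q => G q.1
    _ = _ := by simp [Fintype.sum_prod_type, Finset.mul_sum]

end PiSums

/-! ### Paths: joint labels of all messages -/

variable {r : ℕ}

/-- The dimensions of `X₁, …, X_{r+1}` and `Y₁, …, Y_r`. -/
def Spaces.dim (H : Spaces r) : Fin (r + 1) ⊕ Fin r → ℕ := Sum.elim H.inDim H.outDim

/-- Joint basis labels of all the spaces `X₁, …, X_{r+1}, Y₁, …, Y_r`. -/
abbrev Spaces.Path (H : Spaces r) : Type := ∀ s : Fin (r + 1) ⊕ Fin r, Fin (H.dim s)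

namespace Spaces

variable {H : Spaces r}

theorem dim_pos (s : Fin (r + 1) ⊕ Fin r) : 0 < H.dim s := by
  cases s
  exacts [H.inDim_pos _, H.outDim_pos _]

/-- The label of `X_{k+1}`. -/
def Path.x (p : H.Path) (k : Fin (r + 1)) : Fin (H.inDim k) := p (Sum.inl k)

/-- The label of `Y_{i+1}`. -/
def Path.y (p : H.Path) (i : Fin r) : Fin (H.outDim i) := p (Sum.inr i)

/-- Replace the label of `X_{k+1}`. -/
def Path.setX (p : H.Path) (k : Fin (r + 1)) (a : Fin (H.inDim k)) : H.Path :=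
  Function.update p (Sum.inl k) a

/-- Replace the label of `Y_{i+1}`. -/
def Path.setY (p : H.Path) (i : Fin r) (b : Fin (H.outDim i)) : H.Path :=
  Function.update p (Sum.inr i) b

@[simp] theorem Path.x_setX_same (p : H.Path) (k : Fin (r + 1)) (a : Fin (H.inDim k)) :
    Path.x (Path.setX p k a) k = a :=
  Function.update_self (β := fun s => Fin (H.dim s)) _ _ _

theorem Path.x_setX_of_ne (p : H.Path) {k j : Fin (r + 1)} (h : j ≠ k) (a : Fin (H.inDim k)) :
    Path.x (Path.setX p k a) j = Path.x p j :=
  Function.update_of_ne (β := fun s => Fin (H.dim s)) (by simpa using h) _ _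

@[simp] theorem Path.y_setX (p : H.Path) (k : Fin (r + 1)) (a : Fin (H.inDim k)) (i : Fin r) :
    Path.y (Path.setX p k a) i = Path.y p i :=
  Function.update_of_ne (β := fun s => Fin (H.dim s)) (Sum.inr_ne_inl (a := k)) a p

@[simp] theorem Path.y_setY_same (p : H.Path) (i : Fin r) (b : Fin (H.outDim i)) :
    Path.y (Path.setY p i b) i = b :=
  Function.update_self (β := fun s => Fin (H.dim s)) _ _ _

theorem Path.y_setY_of_ne (p : H.Path) {i j : Fin r} (h : j ≠ i) (b : Fin (H.outDim i)) :
    Path.y (Path.setY p i b) j = Path.y p j :=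
  Function.update_of_ne (β := fun s => Fin (H.dim s)) (by simpa using h) _ _

@[simp] theorem Path.x_setY (p : H.Path) (i : Fin r) (b : Fin (H.outDim i)) (k : Fin (r + 1)) :
    Path.x (Path.setY p i b) k = Path.x p k :=
  Function.update_of_ne (β := fun s => Fin (H.dim s)) (Sum.inl_ne_inr (b := i)) b p

@[simp] theorem Path.setX_x (p : H.Path) (k : Fin (r + 1)) : Path.setX p k (Path.x p k) = p := by
  simp [Path.x, Path.setX]

@[simp] theorem Path.setY_y (p : H.Path) (i : Fin r) : Path.setY p i (Path.y p i) = p := by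
  simp [Path.y, Path.setY]

theorem sum_sum_setX (k : Fin (r + 1)) (G : H.Path → ℂ) :
    ∑ p, ∑ a, G (Path.setX p k a) = H.inDim k * ∑ p, G p := by
  simpa using! sum_sum_update (α := fun s => Fin (H.dim s)) (Sum.inl k) G

theorem sum_sum_setY (i : Fin r) (G : H.Path → ℂ) :
    ∑ p, ∑ b, G (Path.setY p i b) = H.outDim i * ∑ p, G p := by
  simpa using! sum_sum_update (α := fun s => Fin (H.dim s)) (Sum.inr i) G

theorem sum_setX (k : Fin (r + 1)) (a : Fin (H.inDim k)) (G : H.Path → ℂ) :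
    ∑ p, G (Path.setX p k a) = H.inDim k * ∑ p, if Path.x p k = a then G p else 0 := by
  rw [← sum_sum_setX]
  simp

variable (H)

theorem x_last_eq (a b : Fin (H.inDim (Fin.last r))) : a = b := by
  apply Fin.ext
  have ha := a.isLt
  have hb := b.isLt
  have := H.inDim_last
  omega

/-- A path is determined by its output and input labels. -/
def pathEquiv : H.Path ≃ H.Out × H.In where
  toFun p := (Path.y p, fun i => Path.x p i.castSucc)
  invFun q := fun s => match s with
    -- The space X_{r+1} has only one label, so the value 0 loses nothing.
    | Sum.inl k => Fin.lastCases (motive := fun k => Fin (H.inDim k)) ⟨0, H.inDim_pos _⟩ q.2 k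
    | Sum.inr i => q.1 i
  left_inv p := by
    funext s
    rcases s with k | i
    · refine Fin.lastCases ?_ (fun i => ?_) k
      · exact H.x_last_eq _ _
      · exact Fin.lastCases_castSucc (motive := fun k => Fin (H.inDim k)) i
    · rfl
  right_inv q := by
    refine Prod.ext ?_ ?_
    · rfl
    · funext i
      simp [Path.x]

end Spaces

/-- The coordinates that are fixed once `X_{k+1}` has been sent: `X₁, …, X_{k+1}` and
`Y₁, …, Y_k`. -/
def seen (k : Fin (r + 1)) : Finset (Fin (r + 1) ⊕ Fin r) :=
  (Finset.Iic k).disjSum (Finset.univ.filter fun i => i.castSucc < k)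

@[simp] theorem inl_mem_seen {k j : Fin (r + 1)} : Sum.inl j ∈ seen k ↔ j ≤ k := by simp [seen]

@[simp] theorem inr_mem_seen {k : Fin (r + 1)} {i : Fin r} :
    Sum.inr i ∈ seen k ↔ i.castSucc < k := by simp [seen]

theorem seen_zero : seen (0 : Fin (r + 1)) = {Sum.inl 0} := by
  ext s
  rcases s with k | i <;> simp

theorem seen_last : seen (Fin.last r) = Finset.univ := by
  ext s
  rcases s with k | i
  · simp [Fin.le_last]
  · simp [Fin.castSucc_lt_last]

theorem seen_succ (i : Fin r) :
    seen i.succ = insert (Sum.inl i.succ) (insert (Sum.inr i) (seen i.castSucc)) := by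
  ext s
  rcases s with k | j
  · simp only [inl_mem_seen, Finset.mem_insert, Sum.inl.injEq, reduceCtorEq, false_or]
    rw [le_iff_eq_or_lt, Fin.le_castSucc_iff]
  · simp only [inr_mem_seen, Finset.mem_insert, Sum.inr.injEq, reduceCtorEq, false_or,
      Fin.castSucc_lt_castSucc_iff, Fin.castSucc_lt_succ_iff]
    exact le_iff_eq_or_lt

theorem prod_compl_seen (H : Spaces r) (i : Fin r) :
    ∏ s ∈ (seen i.castSucc)ᶜ, H.dim s
      = H.outDim i * H.inDim i.succ * ∏ s ∈ (seen i.succ)ᶜ, H.dim s := by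
  have h1 : (seen i.castSucc)ᶜ
      = insert (Sum.inr i) (insert (Sum.inl i.succ) (seen i.succ)ᶜ) := by
    ext s
    rw [seen_succ]
    have h2 : Sum.inr i ∉ seen i.castSucc := by simp
    have h3 : Sum.inl i.succ ∉ seen i.castSucc := by simp
    simp only [Finset.mem_compl, Finset.mem_insert]
    by_cases hs1 : s = Sum.inr i
    · subst hs1; simp
    · by_cases hs2 : s = Sum.inl i.succ
      · subst hs2; simp
      · simp [hs1, hs2]
  rw [h1, Finset.prod_insert (by simp), Finset.prod_insert (by simp), ← mul_assoc]
  rfl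

/-! ### Path amplitudes and the interaction of a strategy with a co-strategy -/

namespace PureStrategy

variable {H : Spaces r} (A : PureStrategy H)

/-- The amplitude as a function of the joint labels. -/
def pathAmplitude (p : H.Path) (k : Fin (r + 1)) : Fin (A.mem k) → ℂ :=
  A.amplitude (H.pathEquiv p).2 (H.pathEquiv p).1 k

theorem pathAmplitude_zero (p : H.Path) (z) : A.pathAmplitude p 0 z = 1 := rfl

theorem pathAmplitude_succ (p : H.Path) (i : Fin r) (z') :
    A.pathAmplitude p i.succ z' = ∑ z, A.op i (p.y i, z') (p.x i.castSucc, z) *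
      A.pathAmplitude p i.castSucc z := by
  rw [pathAmplitude, amplitude, Fin.induction_succ]
  rfl

theorem pathAmplitude_congr {p p' : H.Path} (k : Fin (r + 1))
    (hx : ∀ j < k, p.x j = p'.x j) (hy : ∀ i : Fin r, i.castSucc < k → p.y i = p'.y i) :
    A.pathAmplitude p k = A.pathAmplitude p' k := by
  induction k using Fin.induction with
  | zero => rfl
  | succ i ih =>
    funext z'
    rw [pathAmplitude_succ, pathAmplitude_succ, hx _ (Fin.castSucc_lt_succ),
      hy _ (Fin.castSucc_lt_succ), ih (fun j hj => hx j (hj.trans Fin.castSucc_lt_succ))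
        (fun j hj => hy j (hj.trans Fin.castSucc_lt_succ))]

/-- The amplitudes of the final memory, as an operator from the memory to `Y ⊗ X`. -/
def amplitudeMatrix : Matrix (H.Out × H.In) (Fin (A.mem (Fin.last r))) ℂ :=
  Matrix.of fun q z => A.amplitude q.2 q.1 (Fin.last r) z

theorem choi_channel : choi A.channel = A.amplitudeMatrix * A.amplitudeMatrixᴴ := by
  ext q q'
  simp [choi, channel, traceRight, Matrix.mul_apply, toMatrix, amplitudeMatrix, Matrix.single_apply,
    ite_and]

end PureStrategy

namespace PureCoStrategy

variable {H : Spaces r} (B : PureCoStrategy H)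

/-- The vector in the memory space after `k` rounds when every message is projected to its
label. -/
def amplitude (p : H.Path) (k : Fin (r + 1)) : Fin (B.mem k) → ℂ :=
  Fin.induction (motive := fun k => Fin (B.mem k) → ℂ)
    (fun w => B.init (p.x 0, w))
    (fun i v w' => ∑ w, B.op i (p.x i.succ, w') (p.y i, w) * v w) k

theorem amplitude_zero (p : H.Path) (w) : B.amplitude p 0 w = B.init (p.x 0, w) := rfl

theorem amplitude_succ (p : H.Path) (i : Fin r) (w') :
    B.amplitude p i.succ w' = ∑ w, B.op i (p.x i.succ, w') (p.y i, w) *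
      B.amplitude p i.castSucc w := by
  rw [amplitude, Fin.induction_succ]
  rfl

theorem amplitude_congr {p p' : H.Path} (k : Fin (r + 1))
    (hx : ∀ j ≤ k, p.x j = p'.x j) (hy : ∀ i : Fin r, i.castSucc < k → p.y i = p'.y i) :
    B.amplitude p k = B.amplitude p' k := by
  induction k using Fin.induction with
  | zero => funext w; rw [amplitude_zero, amplitude_zero, hx 0 le_rfl]
  | succ i ih =>
    funext z'
    rw [amplitude_succ, amplitude_succ, hx _ le_rfl,
      hy _ (Fin.castSucc_lt_succ), ih (fun j hj => hx j (hj.trans Fin.castSucc_lt_succ.le))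
        (fun j hj => hy j (hj.trans Fin.castSucc_lt_succ))]

/-- The amplitudes of the final memory, as an operator from the memory to `Y ⊗ X`. -/
def amplitudeMatrix : Matrix (H.Out × H.In) (Fin (B.mem (Fin.last r))) ℂ :=
  Matrix.of fun q w => B.amplitude (H.pathEquiv.symm q) (Fin.last r) w

/-- The operator on `Y ⊗ X` that represents the co-strategy. -/
def operator : H.Op := (B.amplitudeMatrixᵀ)ᴴ * B.amplitudeMatrixᵀ

end PureCoStrategy

namespace PureStrategy

variable {H : Spaces r} (A : PureStrategy H) (B : PureCoStrategy H)

theorem stateAfter_succ (i : Fin r) (a : Fin (H.inDim i.succ)) (z : Fin (A.mem i.succ))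
    (w : Fin (B.mem i.succ)) :
    A.stateAfter B i.succ (a, z, w) = ∑ y, ∑ w', B.op i (a, w) (y, w') *
      ∑ x, ∑ z', A.op i (y, z) (x, z') * A.stateAfter B i.castSucc (x, z', w') := by
  rw [stateAfter, Fin.induction_succ]
  rfl

/-- The state is a sum of products of amplitudes over the labels seen so far. Summing over full
paths keeps one index type for all rounds; the amplitudes ignore unseen labels, which only
contribute the product of their dimensions. -/
theorem stateAfter_eq_sum (k : Fin (r + 1)) (a : Fin (H.inDim k)) (z : Fin (A.mem k))
    (w : Fin (B.mem k)) :
    (∏ s ∈ (seen k)ᶜ, H.dim s : ℕ) * A.stateAfter B k (a, z, w)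
      = ∑ p : H.Path, if p.x k = a then A.pathAmplitude p k z * B.amplitude p k w else 0 := by
  induction k using Fin.induction with
  | zero =>
    have h := H.sum_setX 0 a fun _ => (1 : ℂ)
    have hcard : (Fintype.card H.Path : ℂ)
        = H.inDim 0 * (∏ s ∈ (seen 0)ᶜ, H.dim s : ℕ) := by
      rw [Fintype.card_pi, ← Finset.prod_mul_prod_compl (seen 0), seen_zero,
        Finset.prod_singleton, Nat.cast_mul]
      simp only [Fintype.card_fin]
      rfl
    have h0 : (H.inDim 0 : ℂ) ≠ 0 := Nat.cast_ne_zero.mpr (H.inDim_pos 0).ne'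
    rw [Finset.sum_const, Finset.card_univ, nsmul_eq_mul, mul_one, hcard] at h
    rw [mul_left_cancel₀ h0 h, Finset.sum_mul]
    refine Finset.sum_congr rfl fun p _ => ?_
    split_ifs with hp
    · subst hp
      rw [pathAmplitude_zero, B.amplitude_zero]
      rfl
    · rw [zero_mul]
  | succ i ih =>
    have hX : (H.inDim i.succ : ℂ) ≠ 0 := Nat.cast_ne_zero.mpr (H.inDim_pos _).ne'
    have hY : (H.outDim i : ℂ) ≠ 0 := Nat.cast_ne_zero.mpr (H.outDim_pos _).ne'
    -- These two factors turn the sum over paths into one in which the two new labels are free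
    -- variables, independent of the path.
    apply mul_left_cancel₀ (mul_ne_zero hY hX)
    rw [mul_assoc (H.outDim i : ℂ) _ (∑ p : H.Path, _), ← H.sum_setX, ← H.sum_sum_setY,
      ← mul_assoc, ← Nat.cast_mul, ← Nat.cast_mul, ← prod_compl_seen, stateAfter_succ]
    have hG : ∀ (p : H.Path) (b : Fin (H.outDim i)),
        A.pathAmplitude ((p.setY i b).setX i.succ a) i.succ z *
          B.amplitude ((p.setY i b).setX i.succ a) i.succ w
        = ∑ w', B.op i (a, w) (b, w') * ∑ x, ∑ z', A.op i (b, z) (x, z') *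
          (if p.x i.castSucc = x then A.pathAmplitude p i.castSucc z' *
            B.amplitude p i.castSucc w' else 0) := by
      intro p b
      have hne : i.castSucc ≠ i.succ := Fin.castSucc_lt_succ.ne
      rw [pathAmplitude_succ, B.amplitude_succ]
      rw [A.pathAmplitude_congr (p' := p) i.castSucc
        (fun j hj => by
          rw [Spaces.Path.x_setX_of_ne _ (hj.trans Fin.castSucc_lt_succ).ne, Spaces.Path.x_setY])
        (fun j hj => by
          rw [Spaces.Path.y_setX, Spaces.Path.y_setY_of_ne _ (by rintro rfl; exact hj.ne rfl)])]
      rw [B.amplitude_congr (p' := p) i.castSucc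
        (fun j hj => by
          rw [Spaces.Path.x_setX_of_ne _ (hj.trans_lt Fin.castSucc_lt_succ).ne,
            Spaces.Path.x_setY])
        (fun j hj => by
          rw [Spaces.Path.y_setX, Spaces.Path.y_setY_of_ne _ (by rintro rfl; exact hj.ne rfl)])]
      simp only [Spaces.Path.y_setX, Spaces.Path.y_setY_same, Spaces.Path.x_setX_same,
        Spaces.Path.x_setX_of_ne _ hne, Spaces.Path.x_setY, mul_ite, mul_zero]
      rw [mul_comm, Finset.sum_mul]
      refine Finset.sum_congr rfl fun w' _ => ?_
      rw [mul_assoc]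
      congr 1
      rw [Finset.sum_eq_single (p.x i.castSucc) (fun c _ hc => by simp [hc.symm]) (by simp),
        Finset.mul_sum]
      refine Finset.sum_congr rfl fun z' _ => ?_
      simp only [if_true]
      ring
    simp only [hG]
    rw [Finset.mul_sum]
    conv_rhs => rw [Finset.sum_comm]
    refine Finset.sum_congr rfl fun b _ => ?_
    rw [Finset.mul_sum]
    conv_rhs => rw [Finset.sum_comm]
    refine Finset.sum_congr rfl fun w' _ => ?_
    rw [← Finset.mul_sum, mul_left_comm]
    congr 1
    rw [Finset.mul_sum]
    conv_rhs => rw [Finset.sum_comm]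
    refine Finset.sum_congr rfl fun x _ => ?_
    rw [Finset.mul_sum]
    conv_rhs => rw [Finset.sum_comm]
    refine Finset.sum_congr rfl fun z' _ => ?_
    rw [← Finset.mul_sum, mul_left_comm, ih]

theorem finalState_eq_sum (z : Fin (A.mem (Fin.last r))) (w : Fin (B.mem (Fin.last r))) :
    A.finalState B (z, w) = (B.amplitudeMatrixᵀ * A.amplitudeMatrix) w z := by
  have h := A.stateAfter_eq_sum B (Fin.last r) ⟨0, H.inDim_pos _⟩ z w
  rw [seen_last, Finset.compl_univ, Finset.prod_empty, Nat.cast_one, one_mul] at h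
  rw [finalState, h, Matrix.mul_apply, ← H.pathEquiv.sum_comp]
  refine Finset.sum_congr rfl fun p _ => ?_
  rw [if_pos (H.x_last_eq _ _), mul_comm]
  simp [PureCoStrategy.amplitudeMatrix, amplitudeMatrix, pathAmplitude]

theorem reducedState_eq : A.reducedState B
    = (B.amplitudeMatrixᵀ * A.amplitudeMatrix) * (B.amplitudeMatrixᵀ * A.amplitudeMatrix)ᴴ := by
  ext w w'
  rw [reducedState, traceLeft, of_apply, Matrix.mul_apply]
  refine Finset.sum_congr rfl fun z _ => ?_
  rw [vecMulVec_apply, Pi.star_apply, finalState_eq_sum, finalState_eq_sum, conjTranspose_apply]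

/-- This bilinear form separates the two players: purifications on the outside, the co-strategy
operator in the middle. -/
theorem fidelity_reducedState (A₁ A₂ : PureStrategy H) :
    fidelity (A₁.reducedState B) (A₂.reducedState B)
      = rectTraceNorm (A₁.amplitudeMatrixᴴ * B.operator * A₂.amplitudeMatrix) := by
  rw [reducedState_eq, reducedState_eq, fidelity_mul_conjTranspose, PureCoStrategy.operator,
    conjTranspose_mul]
  simp only [Matrix.mul_assoc]

theorem sum_stateAfter (k : Fin (r + 1)) :
    ∑ p, star (A.stateAfter B k p) * A.stateAfter B k p = 1 := by
  induction k using Fin.induction with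
  | zero =>
    have hu := congrArg (fun t : ℝ => (t : ℂ)) B.init_unit
    simp only [Complex.ofReal_sum, Complex.ofReal_pow, Complex.ofReal_one,
      Fintype.sum_prod_type] at hu
    rw [← hu, Fintype.sum_prod_type]
    refine Finset.sum_congr rfl fun x _ => ?_
    rw [Fintype.sum_prod_type, Finset.sum_comm]
    refine Finset.sum_congr rfl fun w _ => ?_
    have hst : ∀ z, A.stateAfter B 0 (x, z, w) = B.init (x, w) := fun z => rfl
    simp only [hst, Finset.sum_const, Finset.card_univ, Fintype.card_fin, A.mem_zero, one_smul]
    exact RCLike.conj_mul _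
  | succ i ih =>
    rw [← ih]
    -- Slices of the state: `A.op i` acts with the label `w` of the other memory as a spectator, and
    -- `B.op i` acts with `z` as a spectator.
    let φ : Fin (B.mem i.castSucc) → Fin (H.inDim i.castSucc) × Fin (A.mem i.castSucc) → ℂ :=
      fun w q => A.stateAfter B i.castSucc (q.1, q.2, w)
    let χ : Fin (A.mem i.succ) → Fin (H.outDim i) × Fin (B.mem i.castSucc) → ℂ :=
      fun z q => (A.op i *ᵥ φ q.2) (q.1, z)
    have hst : ∀ a z w, A.stateAfter B i.succ (a, z, w) = (B.op i *ᵥ χ z) (a, w) := by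
      intro a z w
      rw [stateAfter_succ]
      simp [χ, φ, mulVec, dotProduct, Fintype.sum_prod_type]
    calc ∑ p, star (A.stateAfter B i.succ p) * A.stateAfter B i.succ p
        = ∑ z, star (B.op i *ᵥ χ z) ⬝ᵥ (B.op i *ᵥ χ z) := by
          simp only [Fintype.sum_prod_type, dotProduct, hst, Pi.star_apply]
          rw [Finset.sum_comm]
      _ = ∑ z, star (χ z) ⬝ᵥ χ z :=
          Finset.sum_congr rfl fun z _ => star_mulVec_dotProduct_mulVec (B.op_isometry i) _
      _ = ∑ w, star (A.op i *ᵥ φ w) ⬝ᵥ (A.op i *ᵥ φ w) := by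
          simp only [Fintype.sum_prod_type, dotProduct, Pi.star_apply, χ]
          rw [Finset.sum_comm' (t' := Finset.univ) (s' := fun _ => Finset.univ) (by simp)]
          conv_rhs => rw [Finset.sum_comm]
          refine Finset.sum_congr rfl fun y _ => Finset.sum_comm
      _ = ∑ w, star (φ w) ⬝ᵥ φ w :=
          Finset.sum_congr rfl fun z _ => star_mulVec_dotProduct_mulVec (A.op_isometry i) _
      _ = _ := by
          simp only [Fintype.sum_prod_type, dotProduct, Pi.star_apply, φ]
          rw [Finset.sum_comm]
          exact Finset.sum_congr rfl fun y _ => Finset.sum_comm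

/-- A strategy and a co-strategy that interact produce a state of norm one. -/
theorem trace_operator_mul_choi : (B.operator * choi A.channel).trace = 1 := by
  have h := A.sum_stateAfter B (Fin.last r)
  rw [Fintype.sum_prod_type, Finset.sum_eq_single ⟨0, H.inDim_pos _⟩
    (fun b _ hb => (hb (H.x_last_eq _ _)).elim) (by simp), Fintype.sum_prod_type,
    Finset.sum_comm] at h
  rw [choi_channel, PureCoStrategy.operator, ← Matrix.mul_assoc, trace_mul_comm,
    ← Matrix.mul_assoc, ← Matrix.mul_assoc, ← conjTranspose_mul, Matrix.mul_assoc, trace_mul_comm,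
    ← h]
  simp only [trace, diag, Matrix.mul_apply (M := B.amplitudeMatrixᵀ * A.amplitudeMatrix)]
  refine Finset.sum_congr rfl fun w _ => Finset.sum_congr rfl fun z _ => ?_
  rw [mul_comm, conjTranspose_apply, ← finalState_eq_sum]
  rfl

end PureStrategy

/-! ### Strategies and co-strategies from compatible kernels -/

section Existence

/-- One round: vectors `g p` in the old memory and `h p a b` in the new memory, for input label `a`
and output label `b`, are related by an isometry as soon as their Gram matrices match. -/
theorem exists_round_isometry {P I O Z Z' : Type*} [Fintype I] [Fintype O] [Fintype Z] [Fintype Z']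
    [DecidableEq I] [DecidableEq Z]
    (hcard : Fintype.card (I × Z) ≤ Fintype.card (O × Z')) (g : P → Z → ℂ)
    (h : P → I → O → Z' → ℂ)
    (hgram : ∀ p p' a a', ∑ b, star (h p a b) ⬝ᵥ h p' a' b
      = if a = a' then star (g p) ⬝ᵥ g p' else 0) :
    ∃ V : Matrix (O × Z') (I × Z) ℂ, Vᴴ * V = 1 ∧
      ∀ p a b z', ∑ z, V (b, z') (a, z) * g p z = h p a b z' := by
  obtain ⟨V, hV, hVu⟩ := exists_isometry_of_gram_eq (τ := P × I) hcard
    (fun t q => if q.1 = t.2 then g t.1 q.2 else 0) (fun t q => h t.1 t.2 q.1 q.2) (by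
      rintro ⟨p, a⟩ ⟨p', a'⟩
      have := hgram p p' a a'
      simp only [dotProduct, Fintype.sum_prod_type, Pi.star_apply] at this ⊢
      rw [this, Finset.sum_eq_single a (fun c _ hc => by simp [hc]) (by simp)]
      by_cases haa : a = a' <;> simp [haa])
  refine ⟨V, hV, fun p a b z' => ?_⟩
  rw [← congrFun (hVu (p, a)) (b, z')]
  simp [mulVec, dotProduct, Fintype.sum_prod_type]

theorem Spaces.card_path_pos (H : Spaces r) : 0 < Fintype.card H.Path :=
  Fintype.card_pos_iff.mpr ⟨fun s => ⟨0, H.dim_pos s⟩⟩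

theorem Spaces.dim_le_card_path (H : Spaces r) (s : Fin (r + 1) ⊕ Fin r) :
    H.dim s ≤ Fintype.card H.Path := by
  rw [Fintype.card_pi]
  simp only [Fintype.card_fin]
  exact Finset.single_le_prod' (f := H.dim) (fun s _ => H.dim_pos s) (Finset.mem_univ s)

/-- Dimension count for memories that grow by a factor `M` each round: an isometry of each round
fits. -/
theorem mul_pow_le {d e M : ℕ} (hd : d ≤ M) (he : 0 < e) (k : ℕ) :
    d * M ^ k ≤ e * M ^ (k + 1) := by
  rw [pow_succ']
  exact (Nat.mul_le_mul_right _ hd).trans (Nat.le_mul_of_pos_left _ he)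

/-- A sequence of positive semidefinite kernels, compatible under the partial traces over the
outputs, comes from a pure strategy. -/
theorem exists_pureStrategy (H : Spaces r) (K : Fin (r + 1) → Matrix H.Path H.Path ℂ)
    (hpsd : ∀ k, (K k).PosSemidef) (hzero : ∀ p p', K 0 p p' = 1)
    (hstep : ∀ i p p' a a', ∑ b, K (Fin.succ i) ((p.setX i.castSucc a).setY i b)
      ((p'.setX i.castSucc a').setY i b) = if a = a' then K i.castSucc p p' else 0) :
    ∃ A : PureStrategy H, ∀ p p', star (A.pathAmplitude p (Fin.last r)) ⬝ᵥ
      A.pathAmplitude p' (Fin.last r) = K (Fin.last r) p p' := by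
  set M := Fintype.card H.Path
  -- Dimension `M ^ k` is 1 at `k = 0`, as Z₀ = ℂ demands, and at least `M` afterwards, which
  -- suffices for Gram vectors indexed by paths.
  have hg : ∀ k : Fin (r + 1), ∃ g : H.Path → Fin (M ^ (k : ℕ)) → ℂ,
      (∀ p p', star (g p) ⬝ᵥ g p' = K k p p') ∧ (k = 0 → ∀ p z, g p z = 1) := by
    intro k
    by_cases hk : k = 0
    · subst hk
      refine ⟨fun _ _ => 1, fun p p' => ?_, fun _ _ _ => rfl⟩
      have hone : ∀ N : ℕ, star (fun _ : Fin N => (1 : ℂ)) ⬝ᵥ (fun _ => 1) = N := fun N => by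
        simp [dotProduct]
      rw [hzero]
      exact (hone _).trans (by simp)
    · obtain ⟨g, hg⟩ := exists_gram_of_posSemidef (hpsd k) (N := M ^ (k : ℕ))
        (Nat.le_self_pow (fun h => hk (Fin.ext h)) M)
      exact ⟨g, hg, fun h => (hk h).elim⟩
  choose g hgram hg0 using hg
  have hV := fun i : Fin r => exists_round_isometry (P := H.Path)
    (I := Fin (H.inDim i.castSucc)) (O := Fin (H.outDim i)) (by
      simp only [Fintype.card_prod, Fintype.card_fin]
      exact mul_pow_le (H.dim_le_card_path (Sum.inl i.castSucc)) (H.outDim_pos i) i)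
    (g i.castSucc) (fun p a b => g i.succ ((p.setX i.castSucc a).setY i b))
    (fun p p' a a' => by simp only [hgram, hstep])
  choose V hViso hVg using hV
  let A : PureStrategy H :=
    { mem := fun k => M ^ (k : ℕ)
      mem_zero := by simp
      op := V
      op_isometry := hViso }
  have hA : ∀ k p, A.pathAmplitude p k = g k p := by
    intro k p
    induction k using Fin.induction with
    | zero => funext z; rw [A.pathAmplitude_zero]; exact (hg0 0 rfl p z).symm
    | succ i ih =>
      funext z'
      rw [A.pathAmplitude_succ, ih]
      refine (hVg i p (p.x i.castSucc) (p.y i) z').trans ?_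
      simp
  refine ⟨A, fun p p' => ?_⟩
  rw [hA, hA]
  exact hgram _ _ _

/-- A sequence of positive semidefinite kernels, compatible under the partial traces over the
inputs, comes from a pure co-strategy. -/
theorem exists_pureCoStrategy (H : Spaces r) (K : Fin (r + 1) → Matrix H.Path H.Path ℂ)
    (hpsd : ∀ k, (K k).PosSemidef)
    (hinit : ∀ p p' : H.Path, ∑ a, K 0 (p.setX 0 a) (p'.setX 0 a) = 1)
    (hstep : ∀ i p p' b b', ∑ a, K (Fin.succ i) ((p.setY i b).setX i.succ a)
      ((p'.setY i b').setX i.succ a) = if b = b' then K i.castSucc p p' else 0) :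
    ∃ B : PureCoStrategy H, ∀ p p', star (B.amplitude p (Fin.last r)) ⬝ᵥ
      B.amplitude p' (Fin.last r) = K (Fin.last r) p p' := by
  set M := Fintype.card H.Path
  have hMpos : 0 < M := H.card_path_pos
  -- The exponent is shifted by one because W₀ must already hold Gram vectors.
  have hg : ∀ k : Fin (r + 1), ∃ g : H.Path → Fin (M ^ ((k : ℕ) + 1)) → ℂ,
      ∀ p p', star (g p) ⬝ᵥ g p' = K k p p' := fun k =>
    exists_gram_of_posSemidef (hpsd k) (Nat.le_self_pow (by simp) M)
  choose g hgram using hg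
  have hV := fun i : Fin r => exists_round_isometry (P := H.Path)
    (I := Fin (H.outDim i)) (O := Fin (H.inDim i.succ)) (by
      simp only [Fintype.card_prod, Fintype.card_fin]
      exact mul_pow_le (H.dim_le_card_path (Sum.inr i)) (H.inDim_pos i.succ) (i + 1))
    (g i.castSucc) (fun p b a => g i.succ ((p.setY i b).setX i.succ a))
    (fun p p' b b' => by simp only [hgram, hstep])
  choose V hViso hVg using hV
  -- The initial unit vector is treated as an isometry out of ℂ.
  obtain ⟨V₀, hV₀iso, hV₀g⟩ := exists_round_isometry (P := H.Path) (I := Unit) (Z := Unit)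
    (O := Fin (H.inDim 0)) (by
      simp only [Fintype.card_prod, Fintype.card_fin, Fintype.card_unit]
      exact Nat.mul_pos (H.inDim_pos 0) (Nat.pow_pos hMpos))
    (fun _ _ => 1) (fun p _ a => g 0 (p.setX 0 a))
    (fun p p' b b' => by simp only [hgram, hinit]; simp)
  let B : PureCoStrategy H :=
    { mem := fun k => M ^ ((k : ℕ) + 1)
      init := fun q => V₀ q ((), ())
      init_unit := by
        have h1 := congrFun (congrFun hV₀iso ((), ())) ((), ())
        simp only [Matrix.mul_apply, conjTranspose_apply, one_apply_eq] at h1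
        have h2 := congrArg Complex.re h1
        rw [Complex.re_sum, Complex.one_re] at h2
        rw [← h2]
        refine Finset.sum_congr rfl fun q _ => ?_
        rw [Complex.star_def, Complex.conj_mul', ← Complex.ofReal_pow, Complex.ofReal_re]
      op := V
      op_isometry := hViso }
  have hB : ∀ k p, B.amplitude p k = g k p := by
    intro k p
    induction k using Fin.induction with
    | zero =>
      funext w
      rw [B.amplitude_zero]
      have := hV₀g p () (p.x 0) w
      rw [Spaces.Path.setX_x, Fintype.sum_unique, mul_one] at this
      exact this
    | succ i ih =>
      funext z'
      rw [B.amplitude_succ, ih]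
      refine (hVg i p (p.y i) (p.x i.succ) z').trans ?_
      simp
  refine ⟨B, fun p p' => ?_⟩
  rw [hB, hB]
  exact hgram _ _ _

/-- Needed so that the infimum in the strategy fidelity is over a nonempty set. -/
theorem nonempty_pureCoStrategy (H : Spaces r) : Nonempty (PureCoStrategy H) := by
  have hV := fun i : Fin r => exists_isometry
    (m := Fin (H.outDim i) × Fin (Fintype.card H.Path ^ (i : ℕ)))
    (n := Fin (H.inDim i.succ) × Fin (Fintype.card H.Path ^ ((i : ℕ) + 1))) (by
      simp only [Fintype.card_prod, Fintype.card_fin]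
      exact mul_pow_le (H.dim_le_card_path (Sum.inr i)) (H.inDim_pos i.succ) i)
  choose V hV using hV
  let q₀ : Fin (H.inDim 0) × Fin (Fintype.card H.Path ^ ((0 : Fin (r + 1)) : ℕ)) :=
    (⟨0, H.inDim_pos 0⟩, ⟨0, Nat.pow_pos H.card_path_pos⟩)
  refine ⟨{ mem := fun k => Fintype.card H.Path ^ (k : ℕ)
            init := Pi.single q₀ 1
            init_unit := ?_
            op := V
            op_isometry := hV }⟩
  rw [Finset.sum_eq_single q₀ (fun q _ hq => by rw [Pi.single_eq_of_ne hq]; simp)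
    (fun h => (h (Finset.mem_univ _)).elim), Pi.single_eq_same]
  simp

end Existence

/-! ### Perturbations of the completely noisy strategy -/

section Duality

-- For ε = 1 / (‖D‖ + 1) one has 1 + εD = ε ((D + ‖D‖) + 1), and D + ‖D‖ ≥ 0.
open scoped MatrixOrder Matrix.Norms.L2Operator in
theorem exists_posSemidef_one_add_smul {n : Type*} [Fintype n] [DecidableEq n] {D : Matrix n n ℂ}
    (hD : D.IsHermitian) : ∃ ε : ℝ, ε ≠ 0 ∧ (1 + (ε : ℂ) • D).PosSemidef := by
  have h := IsSelfAdjoint.neg_algebraMap_norm_le_self (a := D) hD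
  have hpos : 0 < ‖D‖ + 1 := by positivity
  refine ⟨(‖D‖ + 1)⁻¹, inv_ne_zero hpos.ne', ?_⟩
  have h2 : (D + (‖D‖ : ℂ) • 1).PosSemidef := by
    have := Matrix.le_iff.mp h
    rw [sub_neg_eq_add, Algebra.algebraMap_eq_smul_one] at this
    simpa using this
  have h3 := (h2.add PosSemidef.one).smul (a := ((‖D‖ + 1)⁻¹ : ℂ)) (by
    rw [← Complex.ofReal_one, ← Complex.ofReal_add, ← Complex.ofReal_inv]
    exact Complex.zero_le_real.mpr (inv_nonneg.mpr hpos.le))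
  convert h3 using 1
  have hne : (‖D‖ : ℂ) + 1 ≠ 0 := by exact_mod_cast hpos.ne'
  ext i j
  simp only [Matrix.add_apply, Matrix.smul_apply, smul_eq_mul]
  push_cast
  field_simp
  ring

variable {H : Spaces r}

/-- `E` acts as the identity on the coordinate `s`. -/
def IdentityAt (s : Fin (r + 1) ⊕ Fin r) (E : Matrix H.Path H.Path ℂ) : Prop :=
  ∀ p p' u u' v, E (Function.update p s u) (Function.update p' s u')
    = if u = u' then E (Function.update p s v) (Function.update p' s v) else 0

theorem identityAt_one (s : Fin (r + 1) ⊕ Fin r) :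
    IdentityAt s (1 : Matrix H.Path H.Path ℂ) := by
  intro p p' u u' v
  simp only [one_apply, Function.update_eq_iff, Function.update_self]
  by_cases h : u = u'
  · subst h
    simp +contextual [Function.update_of_ne]
  · simp [h]

theorem IdentityAt.add {s : Fin (r + 1) ⊕ Fin r} {E F : Matrix H.Path H.Path ℂ}
    (hE : IdentityAt s E) (hF : IdentityAt s F) : IdentityAt s (E + F) := by
  intro p p' u u' v
  rw [Matrix.add_apply, Matrix.add_apply, hE p p' u u' v, hF p p' u u' v]
  split_ifs <;> simp

theorem IdentityAt.smul {s : Fin (r + 1) ⊕ Fin r} {E : Matrix H.Path H.Path ℂ} (c : ℂ)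
    (hE : IdentityAt s E) : IdentityAt s (c • E) := by
  intro p p' u u' v
  rw [Matrix.smul_apply, Matrix.smul_apply, hE p p' u u' v]
  split_ifs <;> simp

theorem IdentityAt.conjTranspose {s : Fin (r + 1) ⊕ Fin r} {E : Matrix H.Path H.Path ℂ}
    (hE : IdentityAt s E) : IdentityAt s Eᴴ := by
  intro p p' u u' v
  rw [conjTranspose_apply, conjTranspose_apply, hE p' p u' u v]
  simp only [apply_ite star, star_zero, eq_comm]

/-- The matrix `∑ |w q⟩⟨w' q|`. -/
def sumSingle (w w' : H.Path → H.Path) : Matrix H.Path H.Path ℂ :=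
  ∑ q, Matrix.single (w q) (w' q) 1

theorem sumSingle_apply (w w' : H.Path → H.Path) (p p' : H.Path) :
    sumSingle w w' p p' = ∑ q, if w q = p ∧ w' q = p' then 1 else 0 := by
  simp [sumSingle, Matrix.sum_apply, Matrix.single_apply]

theorem sum_mul_sumSingle (Q : Matrix H.Path H.Path ℂ) (w w' : H.Path → H.Path) :
    ∑ p, ∑ p', Q p p' * sumSingle w w' p p' = ∑ q, Q (w q) (w' q) := by
  simp only [sumSingle_apply, Finset.mul_sum]
  rw [Finset.sum_congr rfl fun p _ => Finset.sum_comm, Finset.sum_comm]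
  refine Finset.sum_congr rfl fun q _ => ?_
  rw [Finset.sum_eq_single (w q) (fun c _ hc => by simp [hc.symm]) (by simp),
    Finset.sum_eq_single (w' q) (fun c _ hc => by simp [hc.symm]) (by simp)]
  simp

theorem eq_update_iff {ι : Type*} [DecidableEq ι] {α : ι → Type*} {f g : ∀ s, α s} {s : ι}
    {u v : α s} : Function.update f s u = Function.update g s v ↔ u = v ∧ ∀ t ≠ s, f t = g t := by
  rw [Function.update_eq_iff, Function.update_self]
  refine and_congr_right fun _ => forall₂_congr fun t ht => ?_
  rw [Function.update_of_ne ht]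

/-- Both maps pass the coordinate at `s` through unchanged, so the sum over that coordinate of `q`
produces Σ |v⟩⟨v|, the identity, on that factor. -/
theorem identityAt_sumSingle {s : Fin (r + 1) ⊕ Fin r} {w w' : H.Path → H.Path}
    (hw : ∀ q v, w (Function.update q s v) = Function.update (w q) s v)
    (hw' : ∀ q v, w' (Function.update q s v) = Function.update (w' q) s v) :
    IdentityAt s (sumSingle w w') := by
  classical
  intro p p' u u' v
  have key : ∀ u u' : Fin (H.dim s), (H.dim s : ℂ) *
      sumSingle w w' (Function.update p s u) (Function.update p' s u')
      = if u = u' then ∑ q, if (∀ t ≠ s, w q t = p t) ∧ (∀ t ≠ s, w' q t = p' t) then 1 else 0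
        else 0 := by
    intro u u'
    have := sum_sum_update (α := fun s => Fin (H.dim s)) s
      (fun q => if w q = Function.update p s u ∧ w' q = Function.update p' s u' then (1 : ℂ) else 0)
    rw [Fintype.card_fin] at this
    rw [sumSingle_apply, ← this]
    simp only [hw, hw', eq_update_iff]
    split_ifs with h
    · subst h
      refine Finset.sum_congr rfl fun q _ => ?_
      rw [Finset.sum_eq_single u (fun c _ hc => by simp [hc]) (by simp)]
      simp
    · refine Finset.sum_eq_zero fun q _ => Finset.sum_eq_zero fun c _ => if_neg ?_
      rintro ⟨⟨h1, _⟩, h2, _⟩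
      exact h (h1.symm.trans h2)
  have hd : (H.dim s : ℂ) ≠ 0 := Nat.cast_ne_zero.mpr (H.dim_pos s).ne'
  apply mul_left_cancel₀ hd
  rw [key, mul_ite, mul_zero, key, if_pos rfl]

/-- The coordinates of the rounds before round `k`. -/
def past (k : Fin (r + 1)) : Finset (Fin (r + 1) ⊕ Fin r) :=
  (Finset.Iio k).disjSum (Finset.univ.filter fun i => i.castSucc < k)

@[simp] theorem inl_mem_past {k j : Fin (r + 1)} : Sum.inl j ∈ past k ↔ j < k := by simp [past]

@[simp] theorem inr_mem_past {k : Fin (r + 1)} {i : Fin r} :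
    Sum.inr i ∈ past k ↔ i.castSucc < k := by simp [past]

/-- Set the labels of round `k` and of all later rounds to `0`. -/
def truncate (k : Fin (r + 1)) (p : H.Path) : H.Path :=
  (past k).piecewise p fun s => ⟨0, H.dim_pos s⟩

theorem path_ext {p p' : H.Path} (hx : ∀ k, p.x k = p'.x k) (hy : ∀ i, p.y i = p'.y i) :
    p = p' := by
  funext s
  cases s
  exacts [hx _, hy _]

theorem x_piecewise_of_mem {U : Finset (Fin (r + 1) ⊕ Fin r)} {k : Fin (r + 1)}
    (h : Sum.inl k ∈ U) (p q : H.Path) : Spaces.Path.x (U.piecewise p q) k = p.x k :=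
  Finset.piecewise_eq_of_mem U p q h

theorem x_piecewise_of_notMem {U : Finset (Fin (r + 1) ⊕ Fin r)} {k : Fin (r + 1)}
    (h : Sum.inl k ∉ U) (p q : H.Path) : Spaces.Path.x (U.piecewise p q) k = q.x k :=
  Finset.piecewise_eq_of_notMem U p q h

theorem y_piecewise_of_mem {U : Finset (Fin (r + 1) ⊕ Fin r)} {i : Fin r}
    (h : Sum.inr i ∈ U) (p q : H.Path) : Spaces.Path.y (U.piecewise p q) i = p.y i :=
  Finset.piecewise_eq_of_mem U p q h

theorem y_piecewise_of_notMem {U : Finset (Fin (r + 1) ⊕ Fin r)} {i : Fin r}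
    (h : Sum.inr i ∉ U) (p q : H.Path) : Spaces.Path.y (U.piecewise p q) i = q.y i :=
  Finset.piecewise_eq_of_notMem U p q h

theorem x_truncate_of_lt {k j : Fin (r + 1)} (h : j < k) (p : H.Path) :
    (truncate k p).x j = p.x j := x_piecewise_of_mem (by simpa using h) _ _

theorem x_truncate_of_le {k j : Fin (r + 1)} (h : k ≤ j) (p : H.Path) :
    (truncate k p).x j = ⟨0, H.inDim_pos j⟩ := x_piecewise_of_notMem (by simpa using h) _ _

theorem y_truncate_of_lt {k : Fin (r + 1)} {i : Fin r} (h : i.castSucc < k) (p : H.Path) :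
    (truncate k p).y i = p.y i := y_piecewise_of_mem (by simpa using h) _ _

theorem y_truncate_of_le {k : Fin (r + 1)} {i : Fin r} (h : k ≤ i.castSucc) (p : H.Path) :
    (truncate k p).y i = ⟨0, H.outDim_pos i⟩ := y_piecewise_of_notMem (by simpa using h) _ _

open Spaces.Path in
theorem truncate_succ (i : Fin r) (p : H.Path) (a : Fin (H.inDim i.castSucc))
    (b : Fin (H.outDim i)) :
    truncate i.succ ((p.setX i.castSucc a).setY i b)
      = ((truncate i.castSucc p).setX i.castSucc a).setY i b := by
  refine path_ext (fun j => ?_) fun j => ?_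
  · rw [x_setY]
    rcases lt_trichotomy j i.castSucc with h | h | h
    · rw [x_truncate_of_lt (h.trans Fin.castSucc_lt_succ), x_setX_of_ne _ h.ne, x_setY,
        x_setX_of_ne _ h.ne, x_truncate_of_lt h]
    · subst h
      rw [x_truncate_of_lt Fin.castSucc_lt_succ, x_setX_same, x_setY, x_setX_same]
    · rw [x_truncate_of_le (Fin.castSucc_lt_iff_succ_le.mp h), x_setX_of_ne _ h.ne',
        x_truncate_of_le h.le]
  · rcases lt_trichotomy j i with h | h | h
    · have h' : j.castSucc < i.castSucc := h
      rw [y_truncate_of_lt (h'.trans Fin.castSucc_lt_succ), y_setY_of_ne _ h.ne, y_setX,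
        y_setY_of_ne _ h.ne, y_setX, y_truncate_of_lt h']
    · subst h
      rw [y_truncate_of_lt Fin.castSucc_lt_succ, y_setY_same, y_setY_same]
    · have h' : i.castSucc < j.castSucc := h
      rw [y_truncate_of_le (Fin.castSucc_lt_iff_succ_le.mp h'), y_setY_of_ne _ h.ne', y_setX,
        y_truncate_of_le h'.le]

theorem truncate_setX (i : Fin r) (p : H.Path) :
    (truncate i.castSucc p).setX i.castSucc ⟨0, H.inDim_pos _⟩ = truncate i.castSucc p := by
  rw [← x_truncate_of_le le_rfl p, Spaces.Path.setX_x]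

theorem truncate_setY (i : Fin r) (p : H.Path) :
    (truncate i.castSucc p).setY i ⟨0, H.outDim_pos _⟩ = truncate i.castSucc p := by
  rw [← y_truncate_of_le le_rfl p, Spaces.Path.setY_y]

theorem truncate_last (p : H.Path) : truncate (Fin.last r) p = p :=
  path_ext
    (fun j => by
      rcases (Fin.le_last j).lt_or_eq with h | rfl
      · exact x_truncate_of_lt h p
      · exact H.x_last_eq _ _)
    (fun i => y_truncate_of_lt (Fin.castSucc_lt_last i) p)

theorem truncate_zero (p p' : H.Path) : truncate 0 p = truncate 0 p' :=
  path_ext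
    (fun _ => (x_truncate_of_le (Fin.zero_le _) p).trans (x_truncate_of_le (Fin.zero_le _) p').symm)
    (fun _ => (y_truncate_of_le (Fin.zero_le _) p).trans (y_truncate_of_le (Fin.zero_le _) p').symm)

/-- Acting as the identity on the input and output of round `i` lets both labels be reset to 0. The
input leaves a Kronecker delta, the traced output its dimension. -/
theorem IdentityAt.sum_truncate {i : Fin r} {E : Matrix H.Path H.Path ℂ}
    (hx : IdentityAt (Sum.inl i.castSucc) E) (hy : IdentityAt (Sum.inr i) E) (p p' : H.Path)
    (a a' : Fin (H.inDim i.castSucc)) :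
    ∑ b, E (truncate i.succ ((p.setX i.castSucc a).setY i b))
      (truncate i.succ ((p'.setX i.castSucc a').setY i b))
    = if a = a' then H.outDim i * E (truncate i.castSucc p) (truncate i.castSucc p') else 0 := by
  have hb : ∀ b, E (truncate i.succ ((p.setX i.castSucc a).setY i b))
      (truncate i.succ ((p'.setX i.castSucc a').setY i b))
      = if a = a' then E (truncate i.castSucc p) (truncate i.castSucc p') else 0 := by
    intro b
    have h1 := (hy ((truncate i.castSucc p).setX i.castSucc a)
      ((truncate i.castSucc p').setX i.castSucc a') b b ⟨0, H.outDim_pos i⟩).trans (if_pos rfl)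
    have hcomm : ∀ (q : H.Path) (a : Fin (H.inDim i.castSucc)) (b : Fin (H.outDim i)),
        (q.setX i.castSucc a).setY i b = (q.setY i b).setX i.castSucc a := fun q a b =>
      Function.update_comm (β := fun s => Fin (H.dim s)) (Sum.inl_ne_inr (a := i.castSucc)) a b q
    rw [truncate_succ, truncate_succ]
    refine h1.trans ?_
    change E (Spaces.Path.setY _ i ⟨0, _⟩) (Spaces.Path.setY _ i ⟨0, _⟩) = _
    rw [hcomm, hcomm, truncate_setY, truncate_setY]
    refine (hx _ _ a a' ⟨0, H.inDim_pos _⟩).trans ?_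
    change (if a = a' then E (Spaces.Path.setX _ i.castSucc ⟨0, _⟩)
      (Spaces.Path.setX _ i.castSucc ⟨0, _⟩) else 0) = _
    rw [truncate_setX, truncate_setX]
  rw [Finset.sum_congr rfl fun b _ => hb b]
  split_ifs <;> simp

/-- `D` acts as the identity on all coordinates after round `k`, and its partial trace over the
output of round `k` vanishes. -/
structure IsPerturbation (k : Fin r) (D : Matrix H.Path H.Path ℂ) : Prop where
  identityAt : ∀ s ∉ past k.succ, IdentityAt s D
  sum_setY : ∀ p p' : H.Path, ∑ b, D (p.setY k b) (p'.setY k b) = 0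

theorem IsPerturbation.add {k : Fin r} {D E : Matrix H.Path H.Path ℂ} (hD : IsPerturbation k D)
    (hE : IsPerturbation k E) : IsPerturbation k (D + E) :=
  ⟨fun s hs => (hD.identityAt s hs).add (hE.identityAt s hs), fun p p' => by
    simp [Finset.sum_add_distrib, hD.sum_setY, hE.sum_setY]⟩

theorem IsPerturbation.smul {k : Fin r} {D : Matrix H.Path H.Path ℂ} (c : ℂ)
    (hD : IsPerturbation k D) : IsPerturbation k (c • D) :=
  ⟨fun s hs => (hD.identityAt s hs).smul c, fun p p' => by
    simp [← Finset.mul_sum, hD.sum_setY]⟩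

theorem IsPerturbation.conjTranspose {k : Fin r} {D : Matrix H.Path H.Path ℂ}
    (hD : IsPerturbation k D) : IsPerturbation k Dᴴ :=
  ⟨fun s hs => (hD.identityAt s hs).conjTranspose, fun p p' => by
    simp [← map_sum, hD.sum_setY]⟩

theorem prod_inv_outDim_succ (H : Spaces r) (i : Fin r) :
    (H.outDim i : ℂ) * ∏ j with Fin.castSucc j < i.succ, (H.outDim j : ℂ)⁻¹
      = ∏ j with Fin.castSucc j < i.castSucc, (H.outDim j : ℂ)⁻¹ := by
  have : (Finset.univ.filter fun j : Fin r => j.castSucc < i.succ)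
      = insert i (Finset.univ.filter fun j => j.castSucc < i.castSucc) := by
    ext j
    simp [Fin.castSucc_lt_succ_iff, le_iff_eq_or_lt]
  rw [this, Finset.prod_insert (by simp), mul_inv_cancel_left₀]
  exact Nat.cast_ne_zero.mpr (H.outDim_pos i).ne'

/-- The memory kernel before round `j` may depend only on earlier labels. Truncation enforces this,
and dividing by the dimensions of the earlier outputs absorbs the factor `H.outDim i` of each step.
-/
theorem exists_pureStrategy_of_sum_truncate (E : Fin (r + 1) → Matrix H.Path H.Path ℂ)
    (hpsd : ∀ j, (E j).PosSemidef) (hzero : ∀ p, E 0 p p = 1)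
    (hstep : ∀ (i : Fin r) p p' a a',
      ∑ b, E i.succ (truncate i.succ ((p.setX i.castSucc a).setY i b))
          (truncate i.succ ((p'.setX i.castSucc a').setY i b))
        = if a = a' then H.outDim i * E i.castSucc (truncate i.castSucc p)
          (truncate i.castSucc p') else 0) :
    ∃ A : PureStrategy H, ∀ p p', star (A.pathAmplitude p (Fin.last r)) ⬝ᵥ
      A.pathAmplitude p' (Fin.last r) = (∏ i, (H.outDim i : ℂ)⁻¹) * E (Fin.last r) p p' := by
  let c : Fin (r + 1) → ℂ := fun j => ∏ i with Fin.castSucc i < j, (H.outDim i : ℂ)⁻¹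
  obtain ⟨A, hA⟩ := exists_pureStrategy H
    (fun j => c j • (E j).submatrix (truncate j) (truncate j))
    (fun j => by
      refine ((hpsd j).submatrix _).smul (Finset.prod_nonneg fun i _ => ?_)
      rw [← Complex.ofReal_natCast, ← Complex.ofReal_inv]
      exact Complex.zero_le_real.mpr (by positivity))
    (fun p p' => by
      rw [Matrix.smul_apply, submatrix_apply, truncate_zero p p', hzero]
      simp [c])
    (fun i p p' a a' => by
      simp only [Matrix.smul_apply, submatrix_apply, smul_eq_mul, ← Finset.mul_sum]
      rw [show c i.castSucc = H.outDim i * c i.succ from (prod_inv_outDim_succ H i).symm, hstep]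
      split_ifs <;> ring)
  refine ⟨A, fun p p' => ?_⟩
  rw [hA]
  simp [c, truncate_last, Fin.castSucc_lt_last]

/-- The completely noisy strategy. -/
theorem exists_pureStrategy_noisy (H : Spaces r) :
    ∃ A : PureStrategy H, ∀ p p', star (A.pathAmplitude p (Fin.last r)) ⬝ᵥ
      A.pathAmplitude p' (Fin.last r)
        = (∏ i, (H.outDim i : ℂ)⁻¹) * (1 : Matrix H.Path H.Path ℂ) p p' :=
  exists_pureStrategy_of_sum_truncate (fun _ => 1) (fun _ => PosSemidef.one)
    (fun p => one_apply_eq p)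
    (fun _ _ _ _ _ => (identityAt_one _).sum_truncate (identityAt_one _) _ _ _ _)

/-- A small perturbation of the completely noisy strategy is a strategy. -/
theorem IsPerturbation.exists_pureStrategy {k : Fin r} {D : Matrix H.Path H.Path ℂ}
    (hD : IsPerturbation k D) (hpsd : (1 + D).PosSemidef) :
    ∃ A : PureStrategy H, ∀ p p', star (A.pathAmplitude p (Fin.last r)) ⬝ᵥ
      A.pathAmplitude p' (Fin.last r) = (∏ i, (H.outDim i : ℂ)⁻¹) * (1 + D) p p' := by
  -- The kernel switches from 1 to 1 + D in round `k`. That step is compatible because the partial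
  -- trace of `D` over this output vanishes; later steps, because `D` is the identity there.
  let E : Fin (r + 1) → Matrix H.Path H.Path ℂ := fun j => if k.castSucc < j then 1 + D else 1
  obtain ⟨A, hA⟩ := exists_pureStrategy_of_sum_truncate E
    (fun j => by
      simp only [E]
      split_ifs
      exacts [hpsd, PosSemidef.one])
    (fun p => by simp [E])
    (fun i p p' a a' => by
      have h1 := (identityAt_one (H := H) (Sum.inl i.castSucc)).sum_truncate (identityAt_one _)
        p p' a a'
      rcases lt_trichotomy i k with h | h | h
      · have hE1 : E i.succ = 1 := if_neg (by simpa [Fin.castSucc_lt_succ_iff] using h)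
        have hE2 : E i.castSucc = 1 := if_neg (by simpa using h.le)
        rw [hE1, hE2, h1]
      · subst h
        have hE1 : E i.succ = 1 + D := if_pos Fin.castSucc_lt_succ
        have hE2 : E i.castSucc = 1 := if_neg (by simp)
        have h2 : ∑ b, D (truncate i.succ ((p.setX i.castSucc a).setY i b))
            (truncate i.succ ((p'.setX i.castSucc a').setY i b)) = 0 := by
          simp only [truncate_succ, hD.sum_setY]
        simp only [hE1, hE2, Matrix.add_apply, Finset.sum_add_distrib, h1, h2, add_zero]
      · have hE1 : E i.succ = 1 + D := if_pos (by simpa [Fin.castSucc_lt_succ_iff] using h.le)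
        have hE2 : E i.castSucc = 1 + D := if_pos (by simpa using h)
        have h2 := (hD.identityAt (Sum.inl i.castSucc) (by
          simpa [Fin.succ_le_castSucc_iff] using h)).sum_truncate (hD.identityAt (Sum.inr i) (by
          simpa [Fin.succ_le_castSucc_iff] using h)) p p' a a'
        simp only [hE1, hE2, Matrix.add_apply, Finset.sum_add_distrib, h1, h2]
        split_ifs <;> ring)
  refine ⟨A, fun p p' => ?_⟩
  rw [hA, show E (Fin.last r) = 1 + D from if_pos (Fin.castSucc_lt_last k)]

end Duality

/-! ### Operators that pair to one with every strategy -/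

section CoStrategyOperator

variable {H : Spaces r}

theorem trace_mul_choi (Q : H.Op) (A : PureStrategy H) :
    (Q * choi A.channel).trace = ∑ p, ∑ p', Q (H.pathEquiv p) (H.pathEquiv p') *
      (star (A.pathAmplitude p (Fin.last r)) ⬝ᵥ A.pathAmplitude p' (Fin.last r)) := by
  rw [A.choi_channel, trace, ← H.pathEquiv.sum_comp]
  refine Finset.sum_congr rfl fun p _ => ?_
  rw [diag_apply, Matrix.mul_apply, ← H.pathEquiv.sum_comp]
  refine Finset.sum_congr rfl fun p' _ => ?_
  congr 1
  rw [Matrix.mul_apply, dotProduct]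
  refine Finset.sum_congr rfl fun z _ => ?_
  rw [mul_comm]
  rfl

/-- The pairing of `Q` with an operator on the joint labels, without conjugation. -/
def pairing (Q : H.Op) (D : Matrix H.Path H.Path ℂ) : ℂ :=
  ∑ p, ∑ p', Q (H.pathEquiv p) (H.pathEquiv p') * D p p'

theorem pairing_add (Q : H.Op) (D E : Matrix H.Path H.Path ℂ) :
    pairing Q (D + E) = pairing Q D + pairing Q E := by
  simp [pairing, mul_add, Finset.sum_add_distrib]

theorem pairing_smul (Q : H.Op) (c : ℂ) (D : Matrix H.Path H.Path ℂ) :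
    pairing Q (c • D) = c * pairing Q D := by
  simp [pairing, Finset.mul_sum, mul_left_comm]

theorem prod_inv_outDim_ne_zero (H : Spaces r) : ∏ i, (H.outDim i : ℂ)⁻¹ ≠ 0 :=
  Finset.prod_ne_zero_iff.mpr fun i _ =>
    inv_ne_zero (Nat.cast_ne_zero.mpr (H.outDim_pos i).ne')

/-- A matrix unit on the seen labels and the output of round `k`, identity elsewhere, made traceless
over that output. Summing over all `q` gives both terms the same multiplicity, so the coefficient −1
cancels the trace when b₀ = b₀'. -/
theorem isPerturbation_sumSingle (k : Fin r) (p₀ p₀' : H.Path) (b₀ b₀' : Fin (H.outDim k)) :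
    IsPerturbation k
      (sumSingle (fun q => (seen k.castSucc).piecewise p₀ (q.setY k b₀))
          (fun q => (seen k.castSucc).piecewise p₀' (q.setY k b₀'))
        + (if b₀ = b₀' then (-1 : ℂ) else 0) •
          sumSingle (fun q => (seen k.castSucc).piecewise p₀ q)
            (fun q => (seen k.castSucc).piecewise p₀' q)) := by
  have hmem : Sum.inr k ∉ seen k.castSucc := by simp
  have hset : ∀ (p q : H.Path) (b : Fin (H.outDim k)),
      (seen k.castSucc).piecewise p (q.setY k b)
        = Spaces.Path.setY ((seen k.castSucc).piecewise p q) k b := fun p q b =>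
    (Finset.update_piecewise_of_notMem (π := fun s => Fin (H.dim s)) (seen k.castSucc) p q hmem
      b).symm
  constructor
  · intro s hs
    have hs1 : s ∉ seen k.castSucc := by
      rcases s with j | j
      · simp only [inl_mem_past, not_lt, inl_mem_seen, not_le] at hs ⊢
        exact Fin.castSucc_lt_succ.trans_le hs
      · simp only [inr_mem_past, not_lt, inr_mem_seen] at hs ⊢
        exact Fin.castSucc_lt_succ.le.trans hs
    have hs2 : s ≠ Sum.inr k := by
      rintro rfl
      exact hs (by simp)
    have h1 : ∀ (p q : H.Path) v, (seen k.castSucc).piecewise p (Function.update q s v)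
        = Function.update ((seen k.castSucc).piecewise p q) s v := fun p q v =>
      (Finset.update_piecewise_of_notMem (π := fun s => Fin (H.dim s)) (seen k.castSucc) p q hs1
        v).symm
    have h2 : ∀ (q : H.Path) (b : Fin (H.outDim k)) v,
        Spaces.Path.setY (Function.update q s v) k b = Function.update (q.setY k b) s v :=
      fun q b v => Function.update_comm (β := fun s => Fin (H.dim s)) hs2 v b q
    refine (identityAt_sumSingle (fun q v => ?_) fun q v => ?_).add
      ((identityAt_sumSingle (fun q v => ?_) fun q v => ?_).smul _)
    · rw [h2, h1]
    · rw [h2, h1]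
    · rw [h1]
    · rw [h1]
  · classical
    intro p p'
    let R : H.Path → Prop := fun q =>
      (∀ t ≠ Sum.inr k, (seen k.castSucc).piecewise p₀ q t = p t) ∧
        ∀ t ≠ Sum.inr k, (seen k.castSucc).piecewise p₀' q t = p' t
    have hiff : ∀ (u v : H.Path) (b c : Fin (H.outDim k)), u.setY k b = v.setY k c ↔
        b = c ∧ ∀ t ≠ Sum.inr k, u t = v t := fun u v b c =>
      eq_update_iff (α := fun s => Fin (H.dim s))
    have hiff' : ∀ (u v q : H.Path) (c : Fin (H.outDim k)),
        (seen k.castSucc).piecewise u q = v.setY k c ↔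
          q.y k = c ∧ ∀ t ≠ Sum.inr k, (seen k.castSucc).piecewise u q t = v t := fun u v q c => by
      rw [← hiff, ← hset, Spaces.Path.setY_y]
    have h1 : ∑ b, sumSingle (fun q => (seen k.castSucc).piecewise p₀ (q.setY k b₀))
        (fun q => (seen k.castSucc).piecewise p₀' (q.setY k b₀')) (p.setY k b) (p'.setY k b)
        = if b₀ = b₀' then ∑ q, if R q then 1 else 0 else 0 := by
      simp only [sumSingle_apply, hset, hiff]
      split_ifs with hb
      · subst hb
        rw [Finset.sum_eq_single b₀ (fun c _ hc => by simp [hc.symm]) (by simp)]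
        simp [R]
      · refine Finset.sum_eq_zero fun c _ => Finset.sum_eq_zero fun q _ => if_neg ?_
        rintro ⟨⟨h1, _⟩, h2, _⟩
        exact hb (h1.trans h2.symm)
    have h2 : ∑ b, sumSingle (fun q => (seen k.castSucc).piecewise p₀ q)
        (fun q => (seen k.castSucc).piecewise p₀' q) (p.setY k b) (p'.setY k b)
        = ∑ q, if R q then 1 else 0 := by
      simp only [sumSingle_apply]
      rw [Finset.sum_comm]
      refine Finset.sum_congr rfl fun q _ => ?_
      simp only [hiff']
      rw [Finset.sum_eq_single (q.y k) (fun c _ hc => by simp [hc.symm]) (by simp)]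
      simp [R]
    simp only [Matrix.add_apply, Matrix.smul_apply, Finset.sum_add_distrib, ← Finset.smul_sum, h1,
      h2]
    split_ifs <;> simp

open Spaces.Path in
theorem piecewise_seen_succ (i : Fin r) (p q : H.Path) (b : Fin (H.outDim i))
    (a : Fin (H.inDim i.succ)) :
    (seen i.succ).piecewise ((p.setY i b).setX i.succ a) q
      = (seen i.castSucc).piecewise p ((q.setX i.succ a).setY i b) := by
  refine path_ext (fun j => ?_) fun j => ?_
  · rcases lt_trichotomy j i.succ with h | h | h
    · rw [x_piecewise_of_mem (inl_mem_seen.mpr h.le), x_setX_of_ne _ h.ne, x_setY,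
        x_piecewise_of_mem (inl_mem_seen.mpr (Fin.le_castSucc_iff.mpr h))]
    · subst h
      rw [x_piecewise_of_mem (inl_mem_seen.mpr le_rfl), x_setX_same,
        x_piecewise_of_notMem (by simp), x_setY, x_setX_same]
    · rw [x_piecewise_of_notMem (by simpa using h),
        x_piecewise_of_notMem (by simpa using Fin.castSucc_lt_succ.trans h), x_setY,
        x_setX_of_ne _ h.ne']
  · rcases lt_trichotomy j i with h | h | h
    · have h' : j.castSucc < i.castSucc := h
      rw [y_piecewise_of_mem (inr_mem_seen.mpr (h'.trans Fin.castSucc_lt_succ)), y_setX,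
        y_setY_of_ne _ h.ne, y_piecewise_of_mem (inr_mem_seen.mpr h')]
    · subst h
      rw [y_piecewise_of_mem (inr_mem_seen.mpr Fin.castSucc_lt_succ), y_setX, y_setY_same,
        y_piecewise_of_notMem (by simp), y_setY_same]
    · have h' : i.castSucc < j.castSucc := h
      rw [y_piecewise_of_notMem (by simpa [Fin.succ_le_castSucc_iff] using h),
        y_piecewise_of_notMem (by simpa using h'.le), y_setY_of_ne _ h.ne', y_setX]

variable {Q : H.Op}

theorem IsPerturbation.pairing_one_add (hQ : ∀ A : PureStrategy H, (Q * choi A.channel).trace = 1)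
    {k : Fin r} {D : Matrix H.Path H.Path ℂ} (hD : IsPerturbation k D) (hpsd : (1 + D).PosSemidef) :
    (∏ i, (H.outDim i : ℂ)⁻¹) * pairing Q (1 + D) = 1 := by
  obtain ⟨A, hA⟩ := hD.exists_pureStrategy hpsd
  rw [← hQ A, trace_mul_choi, pairing]
  simp only [hA, Finset.mul_sum]
  refine Finset.sum_congr rfl fun p _ => Finset.sum_congr rfl fun p' _ => ?_
  ring

theorem pairing_one (hQ : ∀ A : PureStrategy H, (Q * choi A.channel).trace = 1) :
    (∏ i, (H.outDim i : ℂ)⁻¹) * pairing Q 1 = 1 := by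
  obtain ⟨A, hA⟩ := exists_pureStrategy_noisy H
  rw [← hQ A, trace_mul_choi, pairing]
  simp only [hA, Finset.mul_sum]
  refine Finset.sum_congr rfl fun p _ => Finset.sum_congr rfl fun p' _ => ?_
  ring

/-- For some ε ≠ 0, both 1 and 1 + εD are strategies up to the same factor, so `Q` pairs equally
with both. -/
theorem IsPerturbation.pairing_eq_zero_of_isHermitian
    (hQ : ∀ A : PureStrategy H, (Q * choi A.channel).trace = 1) {k : Fin r}
    {D : Matrix H.Path H.Path ℂ} (hD : IsPerturbation k D) (hherm : D.IsHermitian) :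
    pairing Q D = 0 := by
  obtain ⟨ε, hε, hpsd⟩ := exists_posSemidef_one_add_smul hherm
  have h1 := (hD.smul ε).pairing_one_add hQ hpsd
  rw [pairing_add, mul_add, pairing_one hQ, pairing_smul, add_eq_left] at h1
  have hεc : (ε : ℂ) ≠ 0 := by exact_mod_cast hε
  exact (mul_eq_zero.mp ((mul_eq_zero.mp h1).resolve_left (prod_inv_outDim_ne_zero H))).resolve_left
    hεc

/-- An operator that pairs to one with all strategies is orthogonal to all perturbations. -/
theorem IsPerturbation.pairing_eq_zero
    (hQ : ∀ A : PureStrategy H, (Q * choi A.channel).trace = 1) {k : Fin r}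
    {D : Matrix H.Path H.Path ℂ} (hD : IsPerturbation k D) : pairing Q D = 0 := by
  -- Perturbations are closed under adjoints, so the Hermitian case applies to D + D* and i(D − D*).
  have h1 := (hD.add hD.conjTranspose).pairing_eq_zero_of_isHermitian hQ (by
    rw [IsHermitian, conjTranspose_add, conjTranspose_conjTranspose, add_comm])
  have h2 := ((hD.add (hD.conjTranspose.smul (-1))).smul Complex.I).pairing_eq_zero_of_isHermitian
    hQ (by
      rw [IsHermitian]
      simp [conjTranspose_smul, conjTranspose_add, add_comm])
  rw [pairing_add] at h1
  rw [pairing_smul, pairing_add, pairing_smul] at h2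
  have h3 := (mul_eq_zero.mp h2).resolve_left Complex.I_ne_zero
  linear_combination (h1 + h3) / 2

/-- The defining linear condition of a co-strategy: with all later messages traced out, `Q` is the
identity on the last output, tensored with a smaller marginal. -/
theorem sum_piecewise_setY (hQ : ∀ A : PureStrategy H, (Q * choi A.channel).trace = 1)
    (k : Fin r) (p p' : H.Path) (b b' : Fin (H.outDim k)) :
    ∑ q : H.Path, Q (H.pathEquiv ((seen k.castSucc).piecewise p (q.setY k b)))
        (H.pathEquiv ((seen k.castSucc).piecewise p' (q.setY k b')))
      = if b = b' then ∑ q : H.Path, Q (H.pathEquiv ((seen k.castSucc).piecewise p q))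
        (H.pathEquiv ((seen k.castSucc).piecewise p' q)) else 0 := by
  have h := (isPerturbation_sumSingle k p p' b b').pairing_eq_zero hQ
  have hs : ∀ w w' : H.Path → H.Path, pairing Q (sumSingle w w')
      = ∑ q, Q (H.pathEquiv (w q)) (H.pathEquiv (w' q)) := fun w w' =>
    sum_mul_sumSingle (Q.submatrix H.pathEquiv H.pathEquiv) w w'
  rw [pairing_add, pairing_smul, hs, hs] at h
  split_ifs with hb
  · rw [if_pos hb] at h
    linear_combination h
  · rw [if_neg hb] at h
    linear_combination h

/-- A positive semidefinite operator that pairs to one with all strategies is represented by a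
pure co-strategy. -/
theorem exists_pureCoStrategy_operator_eq
    (hQ : ∀ A : PureStrategy H, (Q * choi A.channel).trace = 1) (hpsd : Q.PosSemidef) :
    ∃ B : PureCoStrategy H, B.operator = Q := by
  -- The sum over full paths `q` repeats each term once per assignment of the seen labels, and the
  -- trace over the unseen outputs contributes their dimensions. Together these give all output
  -- dimensions and the input dimensions up to `k`.
  let n : Fin (r + 1) → ℂ := fun k =>
    (∏ i, (H.outDim i : ℂ)⁻¹) * ∏ j ∈ Finset.Iic k, (H.inDim j : ℂ)⁻¹
  let K : Fin (r + 1) → Matrix H.Path H.Path ℂ := fun k => n k • ∑ q : H.Path,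
    Q.submatrix (fun p => H.pathEquiv ((seen k).piecewise p q))
      (fun p => H.pathEquiv ((seen k).piecewise p q))
  have hK : ∀ k p p', K k p p' = n k * ∑ q : H.Path,
      Q (H.pathEquiv ((seen k).piecewise p q)) (H.pathEquiv ((seen k).piecewise p' q)) := by
    intro k p p'
    simp [K, Matrix.sum_apply]
  have hdim : ∀ k, (H.inDim k : ℂ) ≠ 0 := fun k => Nat.cast_ne_zero.mpr (H.inDim_pos k).ne'
  have hn0 : n 0 * H.inDim 0 = ∏ i, (H.outDim i : ℂ)⁻¹ := by
    have h0 : Finset.Iic (0 : Fin (r + 1)) = {0} := by ext j; simp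
    simp only [n, h0, Finset.prod_singleton]
    rw [mul_assoc, inv_mul_cancel₀ (hdim 0), mul_one]
  have hn : ∀ i : Fin r, n i.succ * H.inDim i.succ = n i.castSucc := by
    intro i
    have hs : Finset.Iic i.succ = insert i.succ (Finset.Iic i.castSucc) := by
      ext j
      simp only [Finset.mem_Iic, Finset.mem_insert]
      rw [le_iff_eq_or_lt, Fin.le_castSucc_iff]
    simp only [n, hs]
    rw [Finset.prod_insert (by simp), mul_assoc, mul_comm (_ * _) (H.inDim i.succ : ℂ),
      mul_inv_cancel_left₀ (hdim _)]
  have hnlast : n (Fin.last r) * Fintype.card H.Path = 1 := by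
    have hIic : Finset.Iic (Fin.last r) = Finset.univ := by ext j; simp [Fin.le_last]
    have hcard : (Fintype.card H.Path : ℂ) = (∏ k, (H.inDim k : ℂ)) * ∏ i, (H.outDim i : ℂ) := by
      rw [Fintype.card_pi, Fintype.prod_sum_type]
      simp only [Fintype.card_fin, Nat.cast_mul, Nat.cast_prod]
      rfl
    simp only [n, hIic, hcard, Finset.prod_inv_distrib]
    have h1 : ∏ k, (H.inDim k : ℂ) ≠ 0 := Finset.prod_ne_zero_iff.mpr fun k _ => hdim k
    have h2 : ∏ i, (H.outDim i : ℂ) ≠ 0 := Finset.prod_ne_zero_iff.mpr fun i _ =>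
      Nat.cast_ne_zero.mpr (H.outDim_pos i).ne'
    field_simp
  obtain ⟨B, hB⟩ := exists_pureCoStrategy H K
    (by
      intro k
      refine PosSemidef.smul (posSemidef_sum _ fun q _ => hpsd.submatrix _) ?_
      have hnonneg : ∀ d : ℕ, (0 : ℂ) ≤ (d : ℂ)⁻¹ := fun d => by
        rw [← Complex.ofReal_natCast, ← Complex.ofReal_inv]
        exact Complex.zero_le_real.mpr (by positivity)
      exact mul_nonneg (Finset.prod_nonneg fun _ _ => hnonneg _)
        (Finset.prod_nonneg fun _ _ => hnonneg _))
    (by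
      intro p p'
      have hpw : ∀ (p q : H.Path) (a : Fin (H.inDim 0)),
          (seen 0).piecewise (p.setX 0 a) q = q.setX 0 a := fun p q a => by
        rw [seen_zero, Finset.piecewise_singleton]
        exact congrArg (Function.update q (Sum.inl 0)) (Spaces.Path.x_setX_same p 0 a)
      simp only [hK, hpw]
      -- The initial vector has norm one because `Q` pairs to one with the completely noisy
      -- strategy.
      rw [← Finset.mul_sum, Finset.sum_comm,
        H.sum_sum_setX 0 fun q => Q (H.pathEquiv q) (H.pathEquiv q), ← mul_assoc, hn0,
        ← pairing_one hQ]
      simp [pairing, Matrix.one_apply])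
    (by
      intro i p p' b b'
      have hpw : ∀ (p q : H.Path) (b : Fin (H.outDim i)) (a : Fin (H.inDim i.succ)),
          (seen i.succ).piecewise ((p.setY i b).setX i.succ a) q
            = (seen i.castSucc).piecewise p ((q.setX i.succ a).setY i b) :=
        fun p q b a => piecewise_seen_succ i p q b a
      simp only [hK, hpw]
      rw [← Finset.mul_sum, Finset.sum_comm,
        H.sum_sum_setX i.succ fun q =>
          Q (H.pathEquiv ((seen i.castSucc).piecewise p (q.setY i b)))
            (H.pathEquiv ((seen i.castSucc).piecewise p' (q.setY i b'))),
        ← mul_assoc, hn, sum_piecewise_setY hQ, mul_ite, mul_zero])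
  refine ⟨B, ?_⟩
  ext q q'
  have h := hB (H.pathEquiv.symm q) (H.pathEquiv.symm q')
  rw [hK, seen_last] at h
  simp only [Finset.piecewise_univ, Equiv.apply_symm_apply, Finset.sum_const, Finset.card_univ,
    nsmul_eq_mul, ← mul_assoc, hnlast, one_mul] at h
  exact h

end CoStrategyOperator

/-! ### Pulling a co-strategy back through a supermap -/

section Monotonicity

/-- The value depends only on C C* and D D*, that is, not on the chosen purifications. -/
theorem rectTraceNorm_mul_mul_congr {l m m' n n' : Type*} [Fintype l] [Fintype m] [Fintype m']
    [Fintype n] [Fintype n'] [DecidableEq m] [DecidableEq m'] [DecidableEq n] [DecidableEq n']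
    (Q : Matrix l l ℂ) {C : Matrix l m ℂ} {C' : Matrix l m' ℂ} {D : Matrix l n ℂ}
    {D' : Matrix l n' ℂ} (hC : C * Cᴴ = C' * C'ᴴ) (hD : D * Dᴴ = D' * D'ᴴ) :
    rectTraceNorm (Cᴴ * Q * D) = rectTraceNorm (C'ᴴ * Q * D') := by
  trans rectTraceNorm (C'ᴴ * Q * D)
  · apply rectTraceNorm_congr_left
    calc (Cᴴ * Q * D)ᴴ * (Cᴴ * Q * D) = Dᴴ * Qᴴ * (C * Cᴴ) * (Q * D) := by
          simp only [conjTranspose_mul, conjTranspose_conjTranspose, Matrix.mul_assoc]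
      _ = (C'ᴴ * Q * D)ᴴ * (C'ᴴ * Q * D) := by
          rw [hC]
          simp only [conjTranspose_mul, conjTranspose_conjTranspose, Matrix.mul_assoc]
  · apply rectTraceNorm_congr_right
    calc (C'ᴴ * Q * D) * (C'ᴴ * Q * D)ᴴ = C'ᴴ * Q * (D * Dᴴ) * (Qᴴ * C') := by
          simp only [conjTranspose_mul, conjTranspose_conjTranspose, Matrix.mul_assoc]
      _ = (C'ᴴ * Q * D') * (C'ᴴ * Q * D')ᴴ := by
          rw [hD]
          simp only [conjTranspose_mul, conjTranspose_conjTranspose, Matrix.mul_assoc]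

/-- The columns `K_j s_k` of a Kraus decomposition, side by side. -/
def krausColumns {J m n l : Type*} [Fintype m] (K : J → Matrix n m ℂ) (C : Matrix m l ℂ) :
    Matrix n (J × l) ℂ :=
  Matrix.of fun q z => (K z.1 * C) q z.2

theorem krausColumns_mul_conjTranspose {J m n l : Type*} [Fintype J] [Fintype m] [Fintype l]
    (K : J → Matrix n m ℂ) (C : Matrix m l ℂ) :
    krausColumns K C * (krausColumns K C)ᴴ = ∑ j, K j * (C * Cᴴ) * (K j)ᴴ := by
  have : ∀ j, K j * (C * Cᴴ) * (K j)ᴴ = (K j * C) * (K j * C)ᴴ := fun j => by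
    simp only [conjTranspose_mul, Matrix.mul_assoc]
  simp only [this]
  ext q q'
  rw [Matrix.mul_apply, Fintype.sum_prod_type, Matrix.sum_apply]
  rfl

/-- By the previous independence, `C'` and `D'` may be replaced by the Kraus columns. The left-hand
matrix is then the partial trace over `J` of the right-hand one. -/
theorem rectTraceNorm_kraus_le {J m n l l' k k' : Type*} [Fintype J] [Fintype m] [Fintype n]
    [Fintype l] [Fintype l'] [Fintype k] [Fintype k'] [DecidableEq l] [DecidableEq l']
    [DecidableEq k] [DecidableEq k'] (K : J → Matrix n m ℂ) (Q : Matrix n n ℂ)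
    {C : Matrix m l ℂ} {D : Matrix m l' ℂ} {C' : Matrix n k ℂ} {D' : Matrix n k' ℂ}
    (hC : C' * C'ᴴ = ∑ j, K j * (C * Cᴴ) * (K j)ᴴ)
    (hD : D' * D'ᴴ = ∑ j, K j * (D * Dᴴ) * (K j)ᴴ) :
    rectTraceNorm (Cᴴ * (∑ j, (K j)ᴴ * Q * K j) * D) ≤ rectTraceNorm (C'ᴴ * Q * D') := by
  classical
  rw [← krausColumns_mul_conjTranspose] at hC hD
  rw [rectTraceNorm_mul_mul_congr Q hC hD]
  convert rectTraceNorm_partialTrace_le ((krausColumns K C)ᴴ * Q * krausColumns K D) using 2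
  have : ∀ j, Cᴴ * ((K j)ᴴ * Q * K j) * D = (K j * C)ᴴ * Q * (K j * D) := fun j => by
    simp only [conjTranspose_mul, Matrix.mul_assoc]
  rw [Matrix.mul_sum, Matrix.sum_mul]
  simp only [this]
  ext z z'
  rw [Matrix.sum_apply]
  rfl

variable {r r' : ℕ} {H : Spaces r} {H' : Spaces r'}

theorem PureCoStrategy.posSemidef_operator (B : PureCoStrategy H) : B.operator.PosSemidef :=
  posSemidef_conjTranspose_mul_self _

/-- The witness has as its operator the adjoint of `Υ` applied to `B'.operator`. It pairs to one
with every strategy because `Υ` sends strategies to strategies. -/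
theorem exists_pureCoStrategy_fidelity_le {Υ : H.Op →ₗ[ℂ] H'.Op} (hΥ : IsStrategySupermap Υ)
    (A₁ A₂ : PureStrategy H) (A₁' A₂' : PureStrategy H') (B' : PureCoStrategy H')
    (h₁ : A₁'.IsPurificationOf (Υ (choi A₁.channel)))
    (h₂ : A₂'.IsPurificationOf (Υ (choi A₂.channel))) :
    ∃ B : PureCoStrategy H, fidelity (A₁.reducedState B) (A₂.reducedState B)
      ≤ fidelity (A₁'.reducedState B') (A₂'.reducedState B') := by
  obtain ⟨K, hK⟩ := hΥ.completelyPositive.exists_kraus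
  obtain ⟨B, hB⟩ := exists_pureCoStrategy_operator_eq (H := H)
    (Q := ∑ j, (K j)ᴴ * B'.operator * K j)
    (fun A => by
      obtain ⟨A', hA'⟩ := hΥ.map_strategy (choi A.channel) ⟨A, rfl⟩
      rw [← A'.trace_operator_mul_choi B', hA', hK, Matrix.sum_mul, Matrix.mul_sum, trace_sum,
        trace_sum]
      refine Finset.sum_congr rfl fun j _ => ?_
      rw [← Matrix.mul_assoc, ← Matrix.mul_assoc, trace_mul_comm _ (K j)ᴴ]
      simp only [Matrix.mul_assoc])
    (posSemidef_sum _ fun j _ => B'.posSemidef_operator.conjTranspose_mul_mul_same _)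
  refine ⟨B, ?_⟩
  rw [PureStrategy.fidelity_reducedState, PureStrategy.fidelity_reducedState, hB]
  refine rectTraceNorm_kraus_le K _ ?_ ?_
  · rw [← hK, ← A₁'.choi_channel, ← A₁.choi_channel, h₁]
  · rw [← hK, ← A₂'.choi_channel, ← A₂.choi_channel, h₂]

theorem strategyFidelity_le (S T : H.Op) {A₁ A₂ : PureStrategy H} (B : PureCoStrategy H)
    (h₁ : A₁.IsPurificationOf S) (h₂ : A₂.IsPurificationOf T) :
    strategyFidelity S T ≤ fidelity (A₁.reducedState B) (A₂.reducedState B) := by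
  refine csInf_le ⟨0, ?_⟩ ⟨A₁, A₂, B, h₁, h₂, rfl⟩
  rintro _ ⟨A₁, A₂, B, -, -, rfl⟩
  rw [PureStrategy.fidelity_reducedState]
  exact rectTraceNorm_nonneg _

end Monotonicity

end

end QuantumStrategy

theorem mainTheorem2 {r r' : ℕ} (H : QuantumStrategy.Spaces r) (H' : QuantumStrategy.Spaces r')
    (Υ : H.Op →ₗ[ℂ] H'.Op) (hΥ : QuantumStrategy.IsStrategySupermap Υ)
    (S T : H.Op) (hS : QuantumStrategy.IsStrategy S) (hT : QuantumStrategy.IsStrategy T) :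
    QuantumStrategy.strategyFidelity (Υ S) (Υ T) ≥ QuantumStrategy.strategyFidelity S T := by
  obtain ⟨A₁, rfl⟩ := hS
  obtain ⟨A₂, rfl⟩ := hT
  obtain ⟨A₁', h₁⟩ := hΥ.map_strategy _ ⟨A₁, rfl⟩
  obtain ⟨A₂', h₂⟩ := hΥ.map_strategy _ ⟨A₂, rfl⟩
  obtain ⟨B'⟩ := QuantumStrategy.nonempty_pureCoStrategy H'
  refine le_csInf ⟨_, A₁', A₂', B', h₁, h₂, rfl⟩ ?_
  -- The purifications on the target side are arbitrary, while `A₁` and `A₂` stay fixed.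
  rintro _ ⟨A₁', A₂', B', h₁, h₂, rfl⟩
  obtain ⟨B, hB⟩ := QuantumStrategy.exists_pureCoStrategy_fidelity_le hΥ A₁ A₂ A₁' A₂' B' h₁ h₂
  exact (QuantumStrategy.strategyFidelity_le _ _ B rfl rfl).trans hB
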